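/- Let $0<\alpha<1/2$ and let $(\xi_n)_{n\ge 1}$ be independent random variables on a probability space $(\Omega,\mathbb P)$ with $\mathbb P(\xi_n=1)=n^{-\alpha}$ and $\mathbb P(\xi_n=0)=1-n^{-\alpha}$. Then there is a measurable set $\Omega'\subset\Omega$ with $\mathbb P(\Omega')=1$ such that for every $\omega\in\Omega'$ the set $\{n\ge 1:\xi_n(\omega)=1\}$ is infinite and universally $L^1$-good; that is, if $n_1<n_2<\cdots$ are its elements in increasing order, then for every probability space $(X,\mathcal F,m)$, every measure-preserving transformation $T:X\to X$ (not necessarily invertible) and every $f\in L^1(X,m)$, the limit $$\lim_{N\to\infty}\frac1N\sum_{k=1}^N f(T^{n_k}x)$$ exists (and is finite) for $m$-almost every $x\in X$. -/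

import Mathlib

open MeasureTheory ProbabilityTheory Filter Topology
open scoped ENNReal

universe u v

noncomputable section

/-- The subsequence average `(1/N) ∑ f(T^{n_k} x)` over the first `N` terms of the sequence
`n 0, n 1, …`. -/
def subseqAverage {X : Type*} (T : X → X) (n : ℕ → ℕ) (f : X → ℂ) (N : ℕ) (x : X) : ℂ :=
  (N : ℂ)⁻¹ * ∑ k ∈ Finset.range N, f (T^[n k] x)

/-- A sequence of non-negative integers is universally `L^p`-good if for every measure-preserving
transformation `T` (not necessarily invertible) of a probability space and every `f ∈ L^p`, the
subsequence averages of `f` converge at almost every point. -/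
def UniversallyLpGood (p : ℝ≥0∞) (n : ℕ → ℕ) : Prop :=
  ∀ (X : Type u) [MeasurableSpace X] (m : Measure X) [IsProbabilityMeasure m]
    (T : X → X), MeasurePreserving T m m →
    ∀ f : X → ℂ, MemLp f p m →
      ∀ᵐ x ∂m, ∃ L : ℂ, Tendsto (fun N : ℕ => subseqAverage T n f N x) atTop (𝓝 L)

/-- A set of natural numbers is universally `L^p`-good if it is infinite (so that it can be
listed as a sequence) and the sequence of its elements in increasing order is. -/
def UniversallyLpGoodSet (p : ℝ≥0∞) (S : Set ℕ) : Prop :=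
  S.Infinite ∧ UniversallyLpGood.{u} p (Nat.nth (fun j => j ∈ S))

/-- Independent selector variables `ξ_1, ξ_2, …` with means `τ_1, τ_2, …`. -/
structure IsSelectorSequence {Ω : Type*} [MeasurableSpace Ω] (P : Measure Ω)
    (τ : ℕ+ → ℝ) (ξ : ℕ+ → Ω → ℝ) : Prop where
  measurable : ∀ n, Measurable (ξ n)
  indep : iIndepFun ξ P
  prob_one : ∀ n, P.real {ω | ξ n ω = 1} = τ n
  prob_zero : ∀ n, P.real {ω | ξ n ω = 0} = 1 - τ n

/-- The random set `{n ≥ 1 : ξ_n(ω) = 1}`, as a set of natural numbers. -/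
def selectedSet {Ω : Type*} (ξ : ℕ+ → Ω → ℝ) (ω : Ω) : Set ℕ :=
  {j | ∃ n : ℕ+, (n : ℕ) = j ∧ ξ n ω = 1}

end

/-! Chance enters only once: almost every outcome satisfies the deterministic condition
`IsPseudorandom`, which does not mention any dynamical system, and this condition alone forces
convergence in every system. Let `a` be the indicator sequence, `τ` its mean, of order `k ^ (-α)`,
and `γ = 1 - α`. The autocorrelations of `a - τ` over length `N` are sums of centered products of
total variance about `N ^ (1 - 2α)`, so exponential tails and Borel–Cantelli bound them by `N ^ ((1
- 2α) / 2)` up to logarithms. This beats `N ^ (2γ - 1) = N ^ (1 - 2α)` by a power precisely because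
`α < 1 / 2`.

The core is the weak type (1,1) inequality `measureReal_exists_dyadic_le`. At length `n = 2 ^ j` the
natural height is `n ^ γ`, the size of the counting function. Discard the points with a Birkhoff
average above one (maximal ergodic theorem) and those whose orbit meets a value above `n ^ γ` at a
selected time (a union bound over few times). Elsewhere the `τ`-part is bounded by Abel summation,
and `f` may be replaced by a truncation whose forward orbit sums are at most `2n`. The truncation's
correlations then add up to at most `2n ∫ f`, linear rather than quadratic in `f`, so expanding the
square of the `(a - τ)`-part and applying Chebyshev gives bounds in terms of `∫ f`. The off-diagonal
terms sum over `j` by the power saving, the diagonal ones by a geometric sum over the heights.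

Convergence follows from the Banach principle. By the mean ergodic theorem an integrable function is
invariant plus a bounded coboundary plus a small `L¹` remainder. Averages of the invariant part are
eventually constant. For the coboundary the `τ`-part telescopes and the `(a - τ)`-part is square
summable along a polynomial subsequence, with the gaps filled afterwards. The maximal inequality
controls the remainder. -/

/-! ### Finite sums -/

/-- Abel summation: if the partial sums of `F` grow at most linearly, then sums against
antitone nonnegative weights are controlled by the sum of the weights. -/
theorem sum_antitone_mul_le {τ F : ℕ → ℝ} (hτ : Antitone τ) (hτ0 : ∀ k, 0 ≤ τ k)
    {G : ℕ → ℝ} (hF : ∀ n, ∑ k ∈ Finset.range n, F k ≤ ∑ k ∈ Finset.range n, G k) (n : ℕ) :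
    ∑ k ∈ Finset.range n, τ k * F k ≤ ∑ k ∈ Finset.range n, τ k * G k := by
  -- Abel summation as an induction: lowering the weight of the running sum from `τ n` to `τ (n +
  -- 1)` only loses, since that sum is nonnegative. It is used with `H = G - F`.
  have key : ∀ H : ℕ → ℝ, (∀ n, 0 ≤ ∑ k ∈ Finset.range n, H k) →
      ∀ n, τ n * ∑ k ∈ Finset.range n, H k ≤ ∑ k ∈ Finset.range n, τ k * H k := by
    intro H hH n
    induction n with
    | zero => simp
    | succ n ih =>
      have h1 : τ (n + 1) * ∑ k ∈ Finset.range (n + 1), H k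
          ≤ τ n * ∑ k ∈ Finset.range (n + 1), H k :=
        mul_le_mul_of_nonneg_right (hτ n.le_succ) (hH _)
      rw [Finset.sum_range_succ] at h1 ⊢
      rw [Finset.sum_range_succ]
      linarith [mul_add (τ n) (∑ k ∈ Finset.range n, H k) (H n)]
  have h := key (fun k => G k - F k)
    (fun n => by rw [Finset.sum_sub_distrib]; linarith [hF n]) n
  have h2 : 0 ≤ τ n * ∑ k ∈ Finset.range n, (G k - F k) := by
    refine mul_nonneg (hτ0 n) ?_
    rw [Finset.sum_sub_distrib]; linarith [hF n]
  simp only [mul_sub, Finset.sum_sub_distrib] at h h2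
  linarith

/-- Telescoping against antitone weights. -/
theorem abs_sum_antitone_mul_sub_le {τ u : ℕ → ℝ} (hτ : Antitone τ) (hτ0 : ∀ k, 0 ≤ τ k)
    {K : ℝ} (hu : ∀ k, |u k| ≤ K) (n : ℕ) :
    |∑ k ∈ Finset.range n, τ k * (u k - u (k + 1))| ≤ 2 * K * τ 0 := by
  have hK : 0 ≤ K := (abs_nonneg _).trans (hu 0)
  have hsum : ∀ n, ∑ k ∈ Finset.range n, (u k - u (k + 1)) = u 0 - u n := fun n =>
    Finset.sum_range_sub' u n
  -- The partial sums telescope to `u 0 - u n`, hence are at most `2 * K` in absolute value: they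
  -- are dominated by those of a mass `2 * K` placed at `0`.
  let G : ℕ → ℝ := fun k => if k = 0 then 2 * K else 0
  have hG : ∀ n, ∑ k ∈ Finset.range (n + 1), G k = 2 * K := by
    intro n; simp [G]
  have hGτ : ∀ n, ∑ k ∈ Finset.range (n + 1), τ k * G k = 2 * K * τ 0 := by
    intro n; simp [G]; ring
  rcases n with _ | n
  · simp only [Finset.range_zero, Finset.sum_empty, abs_zero]
    exact mul_nonneg (by linarith) (hτ0 0)
  rw [abs_le]
  constructor
  · have := sum_antitone_mul_le (F := fun k => -(u k - u (k + 1))) (G := G) hτ hτ0 (fun n => by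
      rcases n with _ | n
      · simp
      · rw [hG, Finset.sum_neg_distrib, hsum]
        linarith [abs_le.1 (hu 0), abs_le.1 (hu (n + 1))]) (n + 1)
    rw [hGτ] at this
    simp only [mul_neg, Finset.sum_neg_distrib] at this
    linarith
  · have := sum_antitone_mul_le (F := fun k => (u k - u (k + 1))) (G := G) hτ hτ0 (fun n => by
      rcases n with _ | n
      · simp
      · rw [hG, hsum]
        linarith [abs_le.1 (hu 0), abs_le.1 (hu (n + 1))]) (n + 1)
    rwa [hGτ] at this

/-- Grouping off-diagonal terms by their gap `d + 1` turns the inner sums into autocorrelations;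
under a measure-preserving map the matching integrals depend on the gap alone. -/
theorem sq_sum_range_eq (u : ℕ → ℝ) (N : ℕ) :
    (∑ k ∈ Finset.range N, u k) ^ 2 = ∑ k ∈ Finset.range N, u k ^ 2 +
      2 * ∑ d ∈ Finset.range N, ∑ k ∈ Finset.range (N - (d + 1)), u k * u (k + (d + 1)) := by
  induction N with
  | zero => simp
  | succ N ih =>
    have h1 : ∑ d ∈ Finset.range (N + 1), ∑ k ∈ Finset.range (N + 1 - (d + 1)),
          u k * u (k + (d + 1))
        = ∑ d ∈ Finset.range N, ∑ k ∈ Finset.range (N - (d + 1)), u k * u (k + (d + 1))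
          + ∑ d ∈ Finset.range N, u (N - 1 - d) * u N := by
      rw [Finset.sum_range_succ, ← Finset.sum_add_distrib]
      simp only [Nat.sub_self, Finset.range_zero, Finset.sum_empty, add_zero]
      refine Finset.sum_congr rfl fun d hd => ?_
      have hd' := Finset.mem_range.1 hd
      have : N + 1 - (d + 1) = (N - (d + 1)) + 1 := by omega
      rw [this, Finset.sum_range_succ]
      congr 3 <;> omega
    rw [h1, Finset.sum_range_succ, Finset.sum_range_succ, add_sq, ih, ← Finset.sum_mul,
      Finset.sum_range_reflect u N]
    ring

/-- A geometric sum is comparable to its largest term, here below `t`. This and the next bound sum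
the dyadic scales of the weak type inequality. -/
theorem sum_pow_lt_le {b t : ℝ} (hb : 1 < b) (ht : 0 ≤ t) (J : ℕ) :
    ∑ j ∈ Finset.range J, (if b ^ j < t then b ^ j else 0) ≤ b / (b - 1) * t := by
  have hb1 : 0 < b - 1 := by linarith
  induction J with
  | zero => simp; positivity
  | succ J ih =>
    by_cases h : b ^ J < t
    · calc ∑ j ∈ Finset.range (J + 1), (if b ^ j < t then b ^ j else 0)
          ≤ ∑ j ∈ Finset.range (J + 1), b ^ j := by
            refine Finset.sum_le_sum fun j _ => ?_
            split_ifs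
            · exact le_rfl
            · positivity
        _ = (b ^ (J + 1) - 1) / (b - 1) := geom_sum_eq hb.ne' _
        _ ≤ b / (b - 1) * t := by
            rw [div_mul_eq_mul_div]
            gcongr
            rw [pow_succ]
            nlinarith
    · rw [Finset.sum_range_succ, if_neg h, add_zero]
      exact ih

theorem sum_inv_pow_mul_le {b : ℝ} (hb : 1 < b) (J : ℕ) : ∀ t : ℝ, 0 ≤ t →
    ∑ j ∈ Finset.range J, (if t ≤ b ^ j then t / b ^ j else 0) ≤ b / (b - 1) := by
  have hb1 : 0 < b - 1 := by linarith
  have hb0 : 0 < b := by linarith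
  induction J with
  | zero => intro t _; simp; positivity
  | succ J ih =>
    intro t ht
    -- For `t ≤ 1` compare with the full geometric series; otherwise the scale `j = 0` is absent and
    -- the rest is the same sum for `t / b`.
    by_cases h : t ≤ 1
    · calc ∑ j ∈ Finset.range (J + 1), (if t ≤ b ^ j then t / b ^ j else 0)
          ≤ ∑ j ∈ Finset.range (J + 1), b⁻¹ ^ j := by
            refine Finset.sum_le_sum fun j _ => ?_
            split_ifs
            · rw [inv_pow, ← one_div]; gcongr
            · positivity
        _ ≤ b / (b - 1) := by
            rw [le_div_iff₀ hb1]
            have h1 := mul_neg_geom_sum b⁻¹ (J + 1)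
            have h2 : 0 ≤ b⁻¹ ^ (J + 1) := by positivity
            calc (∑ j ∈ Finset.range (J + 1), b⁻¹ ^ j) * (b - 1)
                = b * ((1 - b⁻¹) * ∑ j ∈ Finset.range (J + 1), b⁻¹ ^ j) := by field_simp
              _ ≤ b := by rw [h1]; nlinarith
    · rw [Finset.sum_range_succ', pow_zero, if_neg h, add_zero]
      refine le_trans (le_of_eq ?_) (ih (t / b) (by positivity))
      refine Finset.sum_congr rfl fun j _ => ?_
      simp only [pow_succ, div_le_iff₀ hb0, div_div, mul_comm b]

/-! ### Measure-preserving maps -/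

/-- The running maximum of the Birkhoff sums of `f` of lengths `0, …, N`. -/
noncomputable def birkhoffMax {X : Type*} (T : X → X) (f : X → ℝ) : ℕ → X → ℝ
  | 0 => fun _ => 0
  | N + 1 => fun x => max 0 (f x + birkhoffMax T f N (T x))

theorem birkhoffMax_nonneg {X : Type*} {T : X → X} (f : X → ℝ) (N : ℕ) (x : X) :
    0 ≤ birkhoffMax T f N x := by
  cases N with
  | zero => exact le_rfl
  | succ N => exact le_max_left _ _

theorem birkhoffMax_le_succ {X : Type*} {T : X → X} (f : X → ℝ) (N : ℕ) :
    ∀ x, birkhoffMax T f N x ≤ birkhoffMax T f (N + 1) x := by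
  induction N with
  | zero => exact fun x => le_max_left _ _
  | succ N ih =>
    intro x
    exact max_le_max le_rfl (add_le_add le_rfl (ih (T x)))

theorem sum_le_birkhoffMax {X : Type*} {T : X → X} (f : X → ℝ) (N : ℕ) : ∀ n ≤ N, ∀ x,
    ∑ k ∈ Finset.range n, f (T^[k] x) ≤ birkhoffMax T f N x := by
  induction N with
  | zero => intro n hn x; simp [Nat.le_zero.1 hn, birkhoffMax]
  | succ N ih =>
    intro n hn x
    rcases n with _ | n
    · simpa using birkhoffMax_nonneg f (N + 1) x
    · rw [Finset.sum_range_succ', add_comm]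
      exact le_max_of_le_right (add_le_add le_rfl (ih n (by omega) (T x)))

section MeasurePreserving

variable {X : Type*} [MeasurableSpace X] {m : Measure X} {T : X → X}

theorem MeasureTheory.MeasurePreserving.integral_comp_measurable {Y : Type*} [MeasurableSpace Y]
    {μ : Measure Y} {S : X → Y} (hS : MeasurePreserving S m μ) {g : Y → ℝ} (hg : Measurable g) :
    ∫ x, g (S x) ∂m = ∫ y, g y ∂μ := by
  rw [← hS.map_eq, integral_map hS.measurable.aemeasurable hg.aestronglyMeasurable]

theorem measurable_birkhoffMax (hT : Measurable T) {f : X → ℝ} (hf : Measurable f) (N : ℕ) :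
    Measurable (birkhoffMax T f N) := by
  induction N with
  | zero => exact measurable_const
  | succ N ih => exact measurable_const.max (hf.add (ih.comp hT))

theorem integrable_birkhoffMax [IsFiniteMeasure m] (hT : MeasurePreserving T m m) {f : X → ℝ}
    (hf : Integrable f m) (N : ℕ) : Integrable (birkhoffMax T f N) m := by
  induction N with
  | zero => exact integrable_zero _ _ _
  | succ N ih =>
    exact (integrable_const 0).sup (hf.add (hT.integrable_comp_of_integrable ih))

/-- The maximal ergodic theorem. -/
theorem setIntegral_birkhoffMax_pos_nonneg [IsFiniteMeasure m] (hT : MeasurePreserving T m m)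
    {f : X → ℝ} (hf : Measurable f) (hfi : Integrable f m) (N : ℕ) :
    0 ≤ ∫ x in {x | 0 < birkhoffMax T f N x}, f x ∂m := by
  set M := birkhoffMax T f N with hM
  have hMm : Measurable M := measurable_birkhoffMax hT.measurable hf N
  have hMi : Integrable M m := integrable_birkhoffMax hT hfi N
  have hMT : Integrable (fun x => M (T x)) m := hT.integrable_comp_of_integrable hMi
  have hs : MeasurableSet {x | 0 < M x} := measurableSet_lt measurable_const hMm
  have h1 : ∫ x in {x | 0 < M x}, M x ∂m = ∫ x, M x ∂m := by
    refine setIntegral_eq_integral_of_forall_compl_eq_zero fun x hx => ?_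
    exact le_antisymm (not_lt.1 hx) (birkhoffMax_nonneg f N x)
  have h2 : ∫ x in {x | 0 < M x}, M (T x) ∂m ≤ ∫ x, M x ∂m := by
    rw [← hT.integral_comp_measurable hMm]
    exact setIntegral_le_integral hMT (Eventually.of_forall fun x => birkhoffMax_nonneg f N _)
  -- Garsia's argument: where the running maximum is positive it equals `f x` plus the shorter
  -- maximum at `T x`, so `M - M ∘ T ≤ f` there, while `∫ M ∘ T = ∫ M`.
  have h3 : ∫ x in {x | 0 < M x}, (M x - M (T x)) ∂m ≤ ∫ x in {x | 0 < M x}, f x ∂m := by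
    refine setIntegral_mono_on (hMi.sub hMT).integrableOn hfi.integrableOn hs fun x hx => ?_
    rcases N with _ | N
    · exact absurd hx (lt_irrefl (0 : ℝ))
    · have h4 : M x = f x + birkhoffMax T f N (T x) := by
        have h5 : M x = max 0 (f x + birkhoffMax T f N (T x)) := rfl
        rcases max_choice 0 (f x + birkhoffMax T f N (T x)) with h | h
        · exact absurd (h5.trans h) (ne_of_gt hx)
        · exact h5.trans h
      have h5 : birkhoffMax T f N (T x) ≤ M (T x) := birkhoffMax_le_succ f N (T x)
      linarith
  rw [integral_sub hMi.integrableOn hMT.integrableOn] at h3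
  linarith

/-- The weak type `(1,1)` bound for the ergodic maximal function, at height one. -/
theorem measureReal_exists_lt_birkhoffSum_le [IsProbabilityMeasure m]
    (hT : MeasurePreserving T m m) {f : X → ℝ} (hf : Measurable f) (hfi : Integrable f m)
    (hf0 : ∀ x, 0 ≤ f x) (N : ℕ) :
    m.real {x | ∃ n ≤ N, (n : ℝ) < ∑ k ∈ Finset.range n, f (T^[k] x)} ≤ ∫ x, f x ∂m := by
  have h := setIntegral_birkhoffMax_pos_nonneg hT (f := fun x => f x - 1) (hf.sub_const 1)
    (hfi.sub (integrable_const 1)) N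
  rw [integral_sub hfi.integrableOn (integrable_const 1).integrableOn] at h
  simp only [setIntegral_const, smul_eq_mul, mul_one] at h
  have h2 : {x | ∃ n ≤ N, (n : ℝ) < ∑ k ∈ Finset.range n, f (T^[k] x)} ⊆
      {x | 0 < birkhoffMax T (fun x => f x - 1) N x} := by
    rintro x ⟨n, hn, hx⟩
    refine lt_of_lt_of_le ?_ (sum_le_birkhoffMax (fun x => f x - 1) N n hn x)
    simp only [Finset.sum_sub_distrib, Finset.sum_const, Finset.card_range, nsmul_eq_mul, mul_one]
    linarith
  calc _ ≤ m.real {x | 0 < birkhoffMax T (fun x => f x - 1) N x} := measureReal_mono h2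
    _ ≤ ∫ x in {x | 0 < birkhoffMax T (fun x => f x - 1) N x}, f x ∂m := by linarith
    _ ≤ ∫ x, f x ∂m := setIntegral_le_integral hfi (Eventually.of_forall hf0)

/-- The `L²` norm of a weighted ergodic sum, in terms of the autocorrelations of the weights. -/
theorem integral_sq_weighted_sum_le [IsFiniteMeasure m] (hT : MeasurePreserving T m m)
    {g : X → ℝ} (hg : Measurable g) {K : ℝ} (hK : ∀ x, |g x| ≤ K) (w : ℕ → ℝ) {N : ℕ} {D : ℝ}
    (hD : ∀ d < N, |∑ k ∈ Finset.range (N - (d + 1)), w k * w (k + (d + 1))| ≤ D) :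
    ∫ x, (∑ k ∈ Finset.range N, w k * g (T^[k] x)) ^ 2 ∂m ≤
      (∑ k ∈ Finset.range N, w k ^ 2) * ∫ x, g x ^ 2 ∂m +
        2 * (D * ∑ d ∈ Finset.range N, |∫ x, g x * g (T^[d + 1] x) ∂m|) := by
  have hK0 : ∀ x, ‖g x‖ ≤ K := hK
  have hint : ∀ i j : ℕ, Integrable (fun x => g (T^[i] x) * g (T^[j] x)) m := by
    intro i j
    refine Integrable.of_bound
      ((hg.comp (hT.iterate i).measurable).mul
        (hg.comp (hT.iterate j).measurable)).aestronglyMeasurable (K * K)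
      (Eventually.of_forall fun x => ?_)
    rw [norm_mul]
    exact mul_le_mul (hK _) (hK _) (norm_nonneg _) ((norm_nonneg _).trans (hK0 x))
  have hshift : ∀ k d : ℕ, ∫ x, g (T^[k] x) * g (T^[k + d] x) ∂m = ∫ x, g x * g (T^[d] x) ∂m := by
    intro k d
    rw [← (hT.iterate k).integral_comp_measurable
      (g := fun x => g x * g (T^[d] x)) (hg.mul (hg.comp (hT.iterate d).measurable))]
    simp only [← Function.iterate_add_apply, add_comm d k]
  have hsq : ∀ k : ℕ, ∫ x, g (T^[k] x) * g (T^[k] x) ∂m = ∫ x, g x ^ 2 ∂m := by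
    intro k
    have := hshift k 0
    simpa [sq] using this
  have hexp : ∀ x, (∑ k ∈ Finset.range N, w k * g (T^[k] x)) ^ 2 =
      ∑ k ∈ Finset.range N, w k ^ 2 * (g (T^[k] x) * g (T^[k] x)) +
      2 * ∑ d ∈ Finset.range N, ∑ k ∈ Finset.range (N - (d + 1)),
        (w k * w (k + (d + 1))) * (g (T^[k] x) * g (T^[k + (d + 1)] x)) := by
    intro x
    rw [sq_sum_range_eq]
    congr 1
    · exact Finset.sum_congr rfl fun k _ => by ring
    · congr 1
      exact Finset.sum_congr rfl fun d _ => Finset.sum_congr rfl fun k _ => by ring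
  simp only [hexp]
  rw [integral_add (integrable_finsetSum _ fun k _ => (hint k k).const_mul _)
    ((integrable_finsetSum _ fun d _ => integrable_finsetSum _ fun k _ =>
      (hint k _).const_mul _).const_mul _), integral_const_mul,
    integral_finsetSum _ fun k _ => (hint k k).const_mul _,
    integral_finsetSum _ fun d _ => integrable_finsetSum _ fun k _ => (hint k _).const_mul _]
  simp only [integral_const_mul, hsq]
  rw [Finset.sum_mul]
  refine add_le_add le_rfl (mul_le_mul_of_nonneg_left ?_ zero_le_two)
  rw [Finset.mul_sum]
  refine Finset.sum_le_sum fun d hd => ?_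
  rw [integral_finsetSum _ fun k _ => (hint k _).const_mul _]
  simp only [integral_const_mul, hshift]
  rw [← Finset.sum_mul]
  refine (le_abs_self _).trans ?_
  rw [abs_mul]
  exact mul_le_mul_of_nonneg_right (hD d (Finset.mem_range.1 hd)) (abs_nonneg _)

end MeasurePreserving

/-! ### The weak type inequality along a pseudorandom set -/

/-- A `0`-`1` sequence `a` that resembles the antitone density `τ`, whose partial sums are of order
`N ^ γ`: it has the same counting function up to a factor tending to one, and the autocorrelations
of `a - τ` exhibit power saving. -/
structure IsPseudorandom (a τ : ℕ → ℝ) (γ δ C : ℝ) : Prop where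
  zero_or_one : ∀ k, a k = 0 ∨ a k = 1
  antitone : Antitone τ
  nonneg : ∀ k, 0 ≤ τ k
  le_one : ∀ k, τ k ≤ 1
  exponent_pos : 0 < γ
  saving_pos : 0 < δ
  saving_le : δ ≤ γ
  sum_le : ∀ N : ℕ, ∑ k ∈ Finset.range N, a k ≤ C * (N : ℝ) ^ γ
  sum_density_le : ∀ N : ℕ, ∑ k ∈ Finset.range N, τ k ≤ C * (N : ℝ) ^ γ
  le_sum_density : ∀ N : ℕ, (N : ℝ) ^ γ ≤ ∑ k ∈ Finset.range N, τ k
  tendsto_ratio : Tendsto (fun N => (∑ k ∈ Finset.range N, a k) / ∑ k ∈ Finset.range N, τ k)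
    atTop (𝓝 1)
  correlation_le : ∀ N d : ℕ, d < N → |∑ k ∈ Finset.range (N - (d + 1)),
    (a k - τ k) * (a (k + (d + 1)) - τ (k + (d + 1)))| ≤ C * (N : ℝ) ^ (2 * γ - 1 - δ)

namespace IsPseudorandom

variable {a τ : ℕ → ℝ} {γ δ C : ℝ}

theorem apply_nonneg (h : IsPseudorandom a τ γ δ C) (k : ℕ) : 0 ≤ a k := by
  rcases h.zero_or_one k with h | h <;> simp [h]

theorem const_nonneg (h : IsPseudorandom a τ γ δ C) : 0 ≤ C := by
  have := h.sum_le 1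
  simp only [Finset.range_one, Finset.sum_singleton, Nat.cast_one, Real.one_rpow, mul_one] at this
  exact (h.apply_nonneg 0).trans this

theorem sum_sq_le (h : IsPseudorandom a τ γ δ C) (N : ℕ) :
    ∑ k ∈ Finset.range N, (a k - τ k) ^ 2 ≤ 2 * C * (N : ℝ) ^ γ := by
  calc ∑ k ∈ Finset.range N, (a k - τ k) ^ 2 ≤ ∑ k ∈ Finset.range N, (a k + τ k) := by
        refine Finset.sum_le_sum fun k _ => ?_
        have h0 := h.nonneg k
        have h1 := h.le_one k
        rcases h.zero_or_one k with h | h <;> rw [h] <;> nlinarith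
    _ ≤ 2 * C * (N : ℝ) ^ γ := by
        rw [Finset.sum_add_distrib]
        linarith [h.sum_le N, h.sum_density_le N]

theorem two_pow_rpow (j : ℕ) (γ : ℝ) : (((2 ^ j : ℕ) : ℝ)) ^ γ = ((2 : ℝ) ^ γ) ^ j := by
  rw [Nat.cast_pow, Nat.cast_ofNat, ← Real.rpow_natCast_mul (by norm_num),
    mul_comm, Real.rpow_mul_natCast (by norm_num)]

theorem one_lt_base (h : IsPseudorandom a τ γ δ C) : 1 < (2 : ℝ) ^ γ :=
  Real.one_lt_rpow one_lt_two h.exponent_pos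

end IsPseudorandom

open Classical in
/-- The part of `f` that is at most `B` and whose forward orbit sums of length `n + 1` are
at most `2 * n`. -/
noncomputable def truncatePart {X : Type*} (T : X → X) (f : X → ℝ) (n : ℕ) (B : ℝ) (x : X) : ℝ :=
  if f x ≤ B ∧ ∑ k ∈ Finset.range (n + 1), f (T^[k] x) ≤ 2 * n then f x else 0

theorem truncatePart_nonneg {X : Type*} {T : X → X} {f : X → ℝ} (hf0 : ∀ x, 0 ≤ f x)
    (n : ℕ) (B : ℝ) (x : X) : 0 ≤ truncatePart T f n B x := by
  unfold truncatePart; split_ifs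
  exacts [hf0 x, le_rfl]

theorem truncatePart_le {X : Type*} {T : X → X} {f : X → ℝ} (hf0 : ∀ x, 0 ≤ f x) (n : ℕ) (B : ℝ) (x : X) :
    truncatePart T f n B x ≤ f x := by
  unfold truncatePart; split_ifs
  exacts [le_rfl, hf0 x]

theorem truncatePart_le_bound {X : Type*} {T : X → X} {f : X → ℝ} (n : ℕ) {B : ℝ} (hB : 0 ≤ B) (x : X) :
    truncatePart T f n B x ≤ B := by
  unfold truncatePart; split_ifs with h
  exacts [h.1, hB]

/-- Where the truncation is nonzero, the forward orbit sum of `f` is at most `2 * n`. Correlations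
of the truncation are thereby linear in `f`, which lets an `L²` argument yield an `L¹` bound. -/
theorem truncatePart_mul_sum_le {X : Type*} {T : X → X} {f : X → ℝ} (hf0 : ∀ x, 0 ≤ f x) (n : ℕ) (B : ℝ) (x : X) :
    truncatePart T f n B x * ∑ d ∈ Finset.range n, truncatePart T f n B (T^[d + 1] x) ≤
      f x * (2 * n) := by
  have hs0 : 0 ≤ ∑ d ∈ Finset.range n, truncatePart T f n B (T^[d + 1] x) :=
    Finset.sum_nonneg fun d _ => truncatePart_nonneg hf0 n B _
  by_cases h : f x ≤ B ∧ ∑ k ∈ Finset.range (n + 1), f (T^[k] x) ≤ 2 * n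
  · refine mul_le_mul (truncatePart_le hf0 n B x) ?_ hs0 (hf0 x)
    refine le_trans ?_ h.2
    rw [Finset.sum_range_succ']
    exact (Finset.sum_le_sum fun d _ => truncatePart_le hf0 n B _).trans
      (le_add_of_nonneg_right (hf0 _))
  · have : truncatePart T f n B x = 0 := if_neg h
    rw [this, zero_mul]
    exact mul_nonneg (hf0 x) (by positivity)

/-- Outside the exceptional sets, the sum over the pseudorandom set is controlled by its
oscillating part applied to the truncation. -/
theorem sum_le_of_not_exceptional {X : Type*} {T : X → X} {a τ : ℕ → ℝ} {γ δ C : ℝ}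
    (h : IsPseudorandom a τ γ δ C) {f : X → ℝ}
    (hf0 : ∀ x, 0 ≤ f x) (n : ℕ) {B : ℝ} {x : X}
    (hx1 : ∀ i ≤ 2 * n, ∑ k ∈ Finset.range i, f (T^[k] x) ≤ i)
    (hx2 : ∀ k < n, a k ≠ 0 → f (T^[k] x) ≤ B) :
    ∑ k ∈ Finset.range n, a k * f (T^[k] x) ≤
      |∑ k ∈ Finset.range n, (a k - τ k) * truncatePart T f n B (T^[k] x)| + C * (n : ℝ) ^ γ := by
  have h1 : ∀ k < n, a k * f (T^[k] x) = a k * truncatePart T f n B (T^[k] x) := by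
    intro k hk
    by_cases hak : a k = 0
    · simp [hak]
    · have hsum : ∑ i ∈ Finset.range (n + 1), f (T^[i] (T^[k] x)) ≤ 2 * n := by
        -- A window of length `n + 1` starting at a time `k < n` ends by time `2 * n`; this is where
        -- the threshold in the truncation comes from.
        have h2 := hx1 (k + (n + 1)) (by omega)
        rw [Finset.sum_range_add] at h2
        have h3 : 0 ≤ ∑ i ∈ Finset.range k, f (T^[i] x) := Finset.sum_nonneg fun i _ => hf0 _
        have h4 : ((k + (n + 1) : ℕ) : ℝ) ≤ 2 * n := by exact_mod_cast (by omega)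
        simp only [← Function.iterate_add_apply]
        simp only [add_comm k] at h2
        push_cast at h4 h2
        linarith
      rw [truncatePart, if_pos ⟨hx2 k hk hak, hsum⟩]
  have h2 : ∑ k ∈ Finset.range n, τ k * truncatePart T f n B (T^[k] x) ≤ C * (n : ℝ) ^ γ := by
    refine le_trans ?_ (h.sum_density_le n)
    -- The Birkhoff bound is known only up to length `2 * n`, whereas the Abel comparison asks for
    -- all lengths, hence the cutoff at `n`.
    let F : ℕ → ℝ := fun k => if k < n then f (T^[k] x) else 0
    have hF : ∀ i, ∑ k ∈ Finset.range i, F k ≤ ∑ k ∈ Finset.range i, (fun _ => (1 : ℝ)) k := by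
      intro i
      simp only [Finset.sum_const, Finset.card_range, nsmul_eq_mul, mul_one]
      have : ∑ k ∈ Finset.range i, F k ≤ ∑ k ∈ Finset.range (min i n), f (T^[k] x) := by
        rw [← Finset.sum_filter]
        refine le_of_eq (Finset.sum_congr ?_ fun _ _ => rfl)
        ext k; simp
      refine this.trans ((hx1 (min i n) (by omega)).trans ?_)
      exact_mod_cast min_le_left i n
    have := sum_antitone_mul_le h.antitone h.nonneg hF n
    simp only [mul_one] at this
    refine le_trans (Finset.sum_le_sum fun k hk => ?_) this
    simp only [F, if_pos (Finset.mem_range.1 hk)]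
    exact mul_le_mul_of_nonneg_left (truncatePart_le hf0 n B _) (h.nonneg k)
  rw [Finset.sum_congr rfl fun k hk => h1 k (Finset.mem_range.1 hk)]
  have h3 : ∑ k ∈ Finset.range n, (a k - τ k) * truncatePart T f n B (T^[k] x) =
      ∑ k ∈ Finset.range n, a k * truncatePart T f n B (T^[k] x) -
      ∑ k ∈ Finset.range n, τ k * truncatePart T f n B (T^[k] x) := by
    rw [← Finset.sum_sub_distrib]
    exact Finset.sum_congr rfl fun k _ => by ring
  have h4 := le_abs_self
    (∑ k ∈ Finset.range n, (a k - τ k) * truncatePart T f n B (T^[k] x))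
  linarith

section WeakType

variable {X : Type*} [MeasurableSpace X] {m : Measure X} {T : X → X}

theorem measurable_truncatePart (hT : Measurable T) {f : X → ℝ} (hf : Measurable f) (n : ℕ)
    (B : ℝ) : Measurable (truncatePart T f n B) := by
  unfold truncatePart
  refine Measurable.ite ?_ hf measurable_const
  have h : Measurable fun x => ∑ k ∈ Finset.range (n + 1), f (T^[k] x) :=
    Finset.measurable_sum _ fun k _ => hf.comp (hT.iterate k)
  exact (measurableSet_le hf measurable_const).inter (measurableSet_le h measurable_const)

variable {a τ : ℕ → ℝ} {γ δ C : ℝ}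

/-- The union bound runs over selected times only, so it costs the counting function `C * n ^ γ`
rather than `n`. -/
theorem measureReal_large_value_le [IsProbabilityMeasure m] (h : IsPseudorandom a τ γ δ C)
    (hT : MeasurePreserving T m m) {f : X → ℝ} (hf : Measurable f) (n : ℕ) (B : ℝ) :
    m.real {x | ∃ k < n, a k ≠ 0 ∧ B < f (T^[k] x)} ≤
      C * (n : ℝ) ^ γ * m.real {x | B < f x} := by
  have hset : {x | ∃ k < n, a k ≠ 0 ∧ B < f (T^[k] x)} =
      ⋃ k ∈ Finset.range n, {x | a k ≠ 0 ∧ B < f (T^[k] x)} := by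
    ext x; simp [and_left_comm]
  rw [hset]
  refine (measureReal_biUnion_finset_le _ _).trans ?_
  calc ∑ k ∈ Finset.range n, m.real {x | a k ≠ 0 ∧ B < f (T^[k] x)}
      ≤ ∑ k ∈ Finset.range n, a k * m.real {x | B < f x} := by
        refine Finset.sum_le_sum fun k _ => ?_
        rcases h.zero_or_one k with hk | hk
        · simp [hk]
        · have : m.real (T^[k] ⁻¹' {x | B < f x}) = m.real {x | B < f x} := by
            rw [measureReal_def, (hT.iterate k).measure_preimage
              (measurableSet_lt measurable_const hf).nullMeasurableSet, measureReal_def]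
          simp only [hk, ne_eq, one_ne_zero, not_false_eq_true, true_and, one_mul]
          exact this.le
    _ ≤ C * (n : ℝ) ^ γ * m.real {x | B < f x} := by
        rw [← Finset.sum_mul]
        exact mul_le_mul_of_nonneg_right (h.sum_le n) measureReal_nonneg

/-- The diagonal costs `∑ (a - τ) ^ 2`. Off the diagonal the correlations of `a - τ` are bounded
uniformly in the gap, and those of the truncation add up to at most `2 * n * ∫ f`. -/
theorem integral_sq_truncatePart_le [IsProbabilityMeasure m] (h : IsPseudorandom a τ γ δ C)
    (hT : MeasurePreserving T m m) {f : X → ℝ} (hf : Measurable f) (hfi : Integrable f m)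
    (hf0 : ∀ x, 0 ≤ f x) (n : ℕ) {B : ℝ} (hB : 0 ≤ B) :
    ∫ x, (∑ k ∈ Finset.range n, (a k - τ k) * truncatePart T f n B (T^[k] x)) ^ 2 ∂m ≤
      2 * C * (n : ℝ) ^ γ * ∫ x, truncatePart T f n B x ^ 2 ∂m +
        2 * (C * (n : ℝ) ^ (2 * γ - 1 - δ) * ((2 * n) * ∫ x, f x ∂m)) := by
  set g := truncatePart T f n B with hg
  have hgm : Measurable g := measurable_truncatePart hT.measurable hf n B
  have hg0 : ∀ x, 0 ≤ g x := truncatePart_nonneg hf0 n B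
  have hgB : ∀ x, |g x| ≤ B := fun x => by
    rw [abs_of_nonneg (hg0 x)]; exact truncatePart_le_bound n hB x
  have hint : ∀ d : ℕ, Integrable (fun x => g x * g (T^[d + 1] x)) m := fun d => by
    refine Integrable.of_bound
      (hgm.mul (hgm.comp (hT.iterate (d + 1)).measurable)).aestronglyMeasurable (B * B)
      (Eventually.of_forall fun x => ?_)
    rw [norm_mul]
    exact mul_le_mul (hgB _) (hgB _) (norm_nonneg _) hB
  refine (integral_sq_weighted_sum_le hT hgm hgB _ (fun d hd => h.correlation_le n d hd)).trans ?_
  refine add_le_add (mul_le_mul_of_nonneg_right (h.sum_sq_le n)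
    (integral_nonneg fun x => sq_nonneg _)) ?_
  refine mul_le_mul_of_nonneg_left (mul_le_mul_of_nonneg_left ?_
    (mul_nonneg h.const_nonneg (by positivity))) zero_le_two
  calc ∑ d ∈ Finset.range n, |∫ x, g x * g (T^[d + 1] x) ∂m|
      = ∑ d ∈ Finset.range n, ∫ x, g x * g (T^[d + 1] x) ∂m :=
        Finset.sum_congr rfl fun d _ =>
          abs_of_nonneg (integral_nonneg fun x => mul_nonneg (hg0 _) (hg0 _))
    _ = ∫ x, g x * ∑ d ∈ Finset.range n, g (T^[d + 1] x) ∂m := by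
        rw [← integral_finsetSum _ fun d _ => hint d]
        simp only [Finset.mul_sum]
    _ ≤ ∫ x, f x * (2 * n) ∂m := by
        refine integral_mono ?_ (hfi.mul_const _) (truncatePart_mul_sum_le hf0 n B)
        simp only [Finset.mul_sum]
        exact integrable_finsetSum _ fun d _ => hint d
    _ = (2 * n) * ∫ x, f x ∂m := by rw [integral_mul_const, mul_comm]

theorem sum_measureReal_large_value_le [IsProbabilityMeasure m] {f : X → ℝ} (hf : Measurable f)
    (hfi : Integrable f m) (hf0 : ∀ x, 0 ≤ f x) {b : ℝ} (hb : 1 < b) (J : ℕ) :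
    ∑ j ∈ Finset.range J, b ^ j * m.real {x | b ^ j < f x} ≤ b / (b - 1) * ∫ x, f x ∂m := by
  have hs : ∀ j : ℕ, MeasurableSet {x | b ^ j < f x} := fun j => measurableSet_lt measurable_const hf
  have h1 : ∀ j : ℕ, b ^ j * m.real {x | b ^ j < f x} =
      ∫ x, (if b ^ j < f x then b ^ j else 0) ∂m := by
    intro j
    have : (fun x => if b ^ j < f x then b ^ j else 0) =
        Set.indicator {x | b ^ j < f x} (fun _ => b ^ j) := by
      ext x; simp [Set.indicator_apply]
    rw [this, integral_indicator_const _ (hs j), smul_eq_mul, mul_comm]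
  have h2 : ∀ j : ℕ, Integrable (fun x => if b ^ j < f x then b ^ j else 0) m := by
    intro j
    refine Integrable.of_bound
      (Measurable.ite (hs j) measurable_const measurable_const).aestronglyMeasurable (b ^ j)
      (Eventually.of_forall fun x => ?_)
    have : 0 < b ^ j := by positivity
    split_ifs
    · exact (Real.norm_of_nonneg this.le).le
    · simpa using this.le
  simp only [h1]
  rw [← integral_finsetSum _ fun j _ => h2 j, ← integral_const_mul]
  exact integral_mono (integrable_finsetSum _ fun j _ => h2 j) (hfi.const_mul _)
    fun x => sum_pow_lt_le hb (hf0 x) J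

/-- Pointwise, only scales with `f x ≤ b ^ j` contribute, and `f x ^ 2 / b ^ j` summed over them is
`f x` times a geometric tail. -/
theorem sum_integral_sq_truncatePart_le [IsProbabilityMeasure m] (hT : Measurable T)
    {f : X → ℝ} (hf : Measurable f) (hfi : Integrable f m) (hf0 : ∀ x, 0 ≤ f x) {b : ℝ}
    (hb : 1 < b) (J : ℕ) (n : ℕ → ℕ) :
    ∑ j ∈ Finset.range J, (∫ x, truncatePart T f (n j) (b ^ j) x ^ 2 ∂m) / b ^ j ≤
      b / (b - 1) * ∫ x, f x ∂m := by
  have hb0 : ∀ j : ℕ, 0 < b ^ j := fun j => by positivity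
  have h2 : ∀ j : ℕ, Integrable (fun x => truncatePart T f (n j) (b ^ j) x ^ 2 / b ^ j) m := by
    intro j
    refine Integrable.of_bound (((measurable_truncatePart hT hf _ _).pow_const
      2).div_const _).aestronglyMeasurable ((b ^ j) ^ 2 / b ^ j)
      (Eventually.of_forall fun x => ?_)
    rw [Real.norm_of_nonneg (div_nonneg (sq_nonneg _) (hb0 j).le)]
    have := truncatePart_nonneg (T := T) hf0 (n j) (b ^ j) x
    have := truncatePart_le_bound (T := T) (f := f) (n j) (hb0 j).le x
    have := hb0 j
    gcongr
  simp only [← integral_div]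
  rw [← integral_finsetSum _ fun j _ => h2 j, ← integral_const_mul]
  refine integral_mono (integrable_finsetSum _ fun j _ => h2 j) (hfi.const_mul _) fun x => ?_
  calc ∑ j ∈ Finset.range J, truncatePart T f (n j) (b ^ j) x ^ 2 / b ^ j
      ≤ ∑ j ∈ Finset.range J, (if f x ≤ b ^ j then f x / b ^ j else 0) * f x := by
        refine Finset.sum_le_sum fun j _ => ?_
        have := hb0 j
        have := hf0 x
        unfold truncatePart
        split_ifs with h1 h2 h2
        · exact le_of_eq (by ring)
        · exact absurd h1.1 h2
        · have : 0 ≤ f x / b ^ j * f x := by positivity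
          simpa using this
        · simp
    _ ≤ b / (b - 1) * f x := by
        rw [← Finset.sum_mul]
        exact mul_le_mul_of_nonneg_right (sum_inv_pow_mul_le hb J (f x) (hf0 x)) (hf0 x)

/-- The weak type constant of a pseudorandom sequence. -/
noncomputable def weakTypeConst (γ δ C : ℝ) : ℝ :=
  1 + 3 * C * ((2 : ℝ) ^ γ / ((2 : ℝ) ^ γ - 1)) + 4 * C * (1 - (2 : ℝ) ^ (-δ))⁻¹

/-- The weak type inequality at height one, over finitely many dyadic lengths. -/
theorem measureReal_exists_dyadic_le [IsProbabilityMeasure m] (h : IsPseudorandom a τ γ δ C)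
    (hT : MeasurePreserving T m m) {f : X → ℝ} (hf : Measurable f) (hfi : Integrable f m)
    (hf0 : ∀ x, 0 ≤ f x) (J : ℕ) :
    m.real {x | ∃ j < J, (C + 1) * ((2 : ℝ) ^ γ) ^ j <
        ∑ k ∈ Finset.range (2 ^ j), a k * f (T^[k] x)} ≤
      weakTypeConst γ δ C * ∫ x, f x ∂m := by
  set b : ℝ := (2 : ℝ) ^ γ with hb
  have hb1 : 1 < b := h.one_lt_base
  have hbj : ∀ j : ℕ, 0 < b ^ j := fun j => by positivity
  have hC := h.const_nonneg
  -- The scale `j` truncation has height `b ^ j = (2 ^ j) ^ γ`, the order of the number of selected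
  -- times below `2 ^ j`.
  set g : ℕ → X → ℝ := fun j => truncatePart T f (2 ^ j) (b ^ j) with hg
  set E : Set X := {x | ∃ n : ℕ, n ≤ 2 * 2 ^ J ∧ (n : ℝ) < ∑ k ∈ Finset.range n, f (T^[k] x)} with hE
  let E₁ : ℕ → Set X := fun j => {x | ∃ k < 2 ^ j, a k ≠ 0 ∧ b ^ j < f (T^[k] x)}
  let E₂ : ℕ → Set X := fun j =>
    {x | b ^ j < |∑ k ∈ Finset.range (2 ^ j), (a k - τ k) * g j (T^[k] x)|}
  have hsub : {x | ∃ j < J, (C + 1) * b ^ j < ∑ k ∈ Finset.range (2 ^ j), a k * f (T^[k] x)} ⊆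
      E ∪ ((⋃ j ∈ Finset.range J, E₁ j) ∪ ⋃ j ∈ Finset.range J, E₂ j) := by
    rintro x ⟨j, hj, hx⟩
    by_contra hcon
    simp only [Set.mem_union, not_or, Set.mem_iUnion, Finset.mem_range, not_exists] at hcon
    obtain ⟨hxE, hx1, hx2⟩ := hcon
    have h1 := sum_le_of_not_exceptional (T := T) h hf0 (2 ^ j) (B := b ^ j) (x := x)
      (fun i hi => by
        by_contra hlt
        refine hxE ⟨i, hi.trans ?_, not_le.1 hlt⟩
        gcongr
        exact one_le_two)
      (fun k hk hak => by
        by_contra hlt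
        exact hx1 j hj ⟨k, hk, hak, not_le.1 hlt⟩)
    rw [IsPseudorandom.two_pow_rpow] at h1
    have h2 : |∑ k ∈ Finset.range (2 ^ j), (a k - τ k) * g j (T^[k] x)| ≤ b ^ j :=
      not_lt.1 (hx2 j hj)
    linarith
  have hE_le : m.real E ≤ ∫ x, f x ∂m := measureReal_exists_lt_birkhoffSum_le hT hf hfi hf0 _
  have hE₁_le : ∑ j ∈ Finset.range J, m.real (E₁ j) ≤ C * (b / (b - 1) * ∫ x, f x ∂m) := by
    refine le_trans ?_ (mul_le_mul_of_nonneg_left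
      (sum_measureReal_large_value_le hf hfi hf0 hb1 J) hC)
    rw [Finset.mul_sum]
    refine Finset.sum_le_sum fun j _ => ?_
    have := measureReal_large_value_le h hT hf (2 ^ j) (b ^ j)
    rw [IsPseudorandom.two_pow_rpow, mul_assoc] at this
    exact this
  have hE₂_j : ∀ j, m.real (E₂ j) ≤ 2 * C * ((∫ x, g j x ^ 2 ∂m) / b ^ j) +
      4 * C * ((2 : ℝ) ^ (-δ)) ^ j * ∫ x, f x ∂m := by
    intro j
    have h1 := integral_sq_truncatePart_le h hT hf hfi hf0 (2 ^ j) (hbj j).le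
    have hgm : Measurable (g j) := measurable_truncatePart hT.measurable hf _ _
    have hsm : Measurable (fun x => ∑ k ∈ Finset.range (2 ^ j), (a k - τ k) * g j (T^[k] x)) :=
      Finset.measurable_sum _ fun k _ => (hgm.comp (hT.iterate k).measurable).const_mul _
    have hint : Integrable
        (fun x => (∑ k ∈ Finset.range (2 ^ j), (a k - τ k) * g j (T^[k] x)) ^ 2) m := by
      refine Integrable.of_bound (hsm.pow_const 2).aestronglyMeasurable
        ((∑ k ∈ Finset.range (2 ^ j), |a k - τ k| * b ^ j) ^ 2) (Eventually.of_forall fun x => ?_)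
      rw [norm_pow]
      refine pow_le_pow_left₀ (norm_nonneg _) (norm_sum_le_of_le _ fun k _ => ?_) 2
      rw [norm_mul]
      refine mul_le_mul_of_nonneg_left ?_ (norm_nonneg _)
      rw [Real.norm_of_nonneg (truncatePart_nonneg hf0 _ _ _)]
      exact truncatePart_le_bound _ (hbj j).le _
    have h2 := mul_meas_ge_le_integral_of_nonneg (Eventually.of_forall fun x => sq_nonneg _) hint
      ((b ^ j) ^ 2)
    have h3 : m.real (E₂ j) ≤ m.real {x | (b ^ j) ^ 2 ≤
        (∑ k ∈ Finset.range (2 ^ j), (a k - τ k) * g j (T^[k] x)) ^ 2} := by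
      refine measureReal_mono fun x hx => ?_
      have hx' : b ^ j < |∑ k ∈ Finset.range (2 ^ j), (a k - τ k) * g j (T^[k] x)| := hx
      show (b ^ j) ^ 2 ≤ _
      rw [← sq_abs (∑ k ∈ Finset.range (2 ^ j), _)]
      exact pow_le_pow_left₀ (hbj j).le hx'.le 2
    have hpos : 0 < (b ^ j) ^ 2 := by have := hbj j; positivity
    have h4 : (b ^ j) ^ 2 * m.real (E₂ j) ≤
        2 * C * ((2 ^ j : ℕ) : ℝ) ^ γ * ∫ x, g j x ^ 2 ∂m +
        2 * (C * ((2 ^ j : ℕ) : ℝ) ^ (2 * γ - 1 - δ) * ((2 * ((2 ^ j : ℕ) : ℝ)) * ∫ x, f x ∂m)) :=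
      (mul_le_mul_of_nonneg_left h3 hpos.le).trans (h2.trans h1)
    have h5 : ((2 ^ j : ℕ) : ℝ) ^ (2 * γ - 1 - δ) * ((2 ^ j : ℕ) : ℝ) =
        (b ^ j) ^ 2 * ((2 : ℝ) ^ (-δ)) ^ j := by
      have hp : (0 : ℝ) < ((2 ^ j : ℕ) : ℝ) := by positivity
      rw [← Real.rpow_add_one hp.ne', hb, ← IsPseudorandom.two_pow_rpow,
        ← IsPseudorandom.two_pow_rpow, ← Real.rpow_mul_natCast hp.le, ← Real.rpow_add hp]
      congr 1; push_cast; ring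
    rw [IsPseudorandom.two_pow_rpow, ← hb] at h4
    rw [← mul_le_mul_iff_right₀ hpos]
    refine h4.trans (le_of_eq ?_)
    calc 2 * C * b ^ j * ∫ x, g j x ^ 2 ∂m +
        2 * (C * ((2 ^ j : ℕ) : ℝ) ^ (2 * γ - 1 - δ) * ((2 * ((2 ^ j : ℕ) : ℝ)) * ∫ x, f x ∂m))
        = 2 * C * b ^ j * ∫ x, g j x ^ 2 ∂m +
        4 * C * (((2 ^ j : ℕ) : ℝ) ^ (2 * γ - 1 - δ) * ((2 ^ j : ℕ) : ℝ)) * ∫ x, f x ∂m := by ring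
      _ = _ := by
        rw [h5]
        have := (hbj j).ne'
        field_simp
  have hr0 : (0 : ℝ) ≤ (2 : ℝ) ^ (-δ) := by positivity
  have hr1 : (2 : ℝ) ^ (-δ) < 1 :=
    Real.rpow_lt_one_of_one_lt_of_neg one_lt_two (neg_lt_zero.2 h.saving_pos)
  have hf_int : 0 ≤ ∫ x, f x ∂m := integral_nonneg hf0
  have hE₂_le : ∑ j ∈ Finset.range J, m.real (E₂ j) ≤ 2 * C * (b / (b - 1) * ∫ x, f x ∂m) +
      4 * C * (1 - (2 : ℝ) ^ (-δ))⁻¹ * ∫ x, f x ∂m := by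
    refine (Finset.sum_le_sum fun j _ => hE₂_j j).trans ?_
    rw [Finset.sum_add_distrib, ← Finset.mul_sum, ← Finset.sum_mul, ← Finset.mul_sum]
    refine add_le_add (mul_le_mul_of_nonneg_left
      (sum_integral_sq_truncatePart_le hT.measurable hf hfi hf0 hb1 J _) (by positivity)) ?_
    refine mul_le_mul_of_nonneg_right (mul_le_mul_of_nonneg_left ?_ (by positivity)) hf_int
    rw [← tsum_geometric_of_lt_one hr0 hr1]
    exact (summable_geometric_of_lt_one hr0 hr1).sum_le_tsum _ fun _ _ => by positivity
  refine (measureReal_mono hsub).trans ((measureReal_union_le _ _).trans ?_)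
  have h6 := measureReal_union_le (μ := m) (⋃ j ∈ Finset.range J, E₁ j)
    (⋃ j ∈ Finset.range J, E₂ j)
  have h7 := measureReal_biUnion_finset_le (μ := m) (Finset.range J) E₁
  have h8 := measureReal_biUnion_finset_le (μ := m) (Finset.range J) E₂
  -- The contributions are `1` from `E`, one multiple of `C * (b / (b - 1))` from `E₁`, two more
  -- from the diagonal part of `E₂`, and the geometric series in `2 ^ (-δ)` from its off-diagonal
  -- part.
  unfold weakTypeConst
  rw [← hb]
  linarith

/-- The weak type `(1,1)` maximal inequality along a pseudorandom set. -/
theorem measure_exists_weighted_sum_gt_le [IsProbabilityMeasure m]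
    (h : IsPseudorandom a τ γ δ C)
    (hT : MeasurePreserving T m m) {f : X → ℝ} (hf : Measurable f) (hfi : Integrable f m)
    (hf0 : ∀ x, 0 ≤ f x) {t : ℝ} (ht : 0 < t) :
    m {x | ∃ N : ℕ, 1 ≤ N ∧ t * (N : ℝ) ^ γ < ∑ k ∈ Finset.range N, a k * f (T^[k] x)} ≤
      ENNReal.ofReal (weakTypeConst γ δ C * ((C + 1) * 2 ^ γ) / t * ∫ x, f x ∂m) := by
  have hC := h.const_nonneg
  set b : ℝ := (2 : ℝ) ^ γ with hb
  have hb0 : 0 < b := by positivity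
  -- Dividing `f` by `s` moves height `t` to the normalised one; the factor `b = 2 ^ γ` pays for
  -- rounding `N` up to a power of two.
  set s : ℝ := t / ((C + 1) * b) with hs
  have hs0 : 0 < s := by positivity
  let S : ℕ → Set X := fun J => {x | ∃ j < J, (C + 1) * b ^ j <
        ∑ k ∈ Finset.range (2 ^ j), a k * (f (T^[k] x) / s)}
  have hsub : {x | ∃ N : ℕ, 1 ≤ N ∧ t * (N : ℝ) ^ γ < ∑ k ∈ Finset.range N, a k * f (T^[k] x)} ⊆
      ⋃ J, S J := by
    rintro x ⟨N, hN, hx⟩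
    set j := Nat.clog 2 N with hj
    have h1 : N ≤ 2 ^ j := Nat.le_pow_clog one_lt_two N
    have h2 : 2 ^ j ≤ 2 * N := by
      rcases Nat.lt_or_ge 1 N with h | h
      · have := Nat.pow_pred_clog_lt_self one_lt_two h
        have hpos : 0 < j := Nat.clog_pos one_lt_two h
        have h3 : 2 ^ j = 2 * 2 ^ (j - 1) := by
          rw [← pow_succ']; congr 1; omega
        rw [h3]
        exact Nat.mul_le_mul_left 2 this.le
      · have : N = 1 := by omega
        rw [hj, this]; simp
    refine Set.mem_iUnion.2 ⟨j + 1, j, Nat.lt_succ_self j, ?_⟩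
    have h3 : b ^ j ≤ b * (N : ℝ) ^ γ := by
      rw [hb, ← IsPseudorandom.two_pow_rpow, ← Real.mul_rpow (by norm_num) (by positivity)]
      exact Real.rpow_le_rpow (by positivity) (by exact_mod_cast h2) h.exponent_pos.le
    calc (C + 1) * b ^ j ≤ (C + 1) * (b * (N : ℝ) ^ γ) := by gcongr
      _ = t * (N : ℝ) ^ γ / s := by rw [hs]; field_simp
      _ < (∑ k ∈ Finset.range N, a k * f (T^[k] x)) / s := by gcongr
      _ ≤ (∑ k ∈ Finset.range (2 ^ j), a k * f (T^[k] x)) / s := by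
          gcongr
          · intro k _ _
            exact mul_nonneg (h.apply_nonneg k) (hf0 _)
      _ = _ := by
          rw [Finset.sum_div]
          exact Finset.sum_congr rfl fun k _ => by rw [mul_div_assoc]
  have hmono : Monotone S := fun J J' hJ x ⟨j, hj, hx⟩ => ⟨j, hj.trans_le hJ, hx⟩
  refine (measure_mono hsub).trans ?_
  rw [hmono.measure_iUnion]
  refine iSup_le fun J => ?_
  have h1 := measureReal_exists_dyadic_le h hT (f := fun x => f x / s) (hf.div_const s)
    (hfi.div_const s) (fun x => div_nonneg (hf0 x) hs0.le) J
  rw [← ofReal_measureReal]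
  refine ENNReal.ofReal_le_ofReal (h1.trans (le_of_eq ?_))
  rw [integral_div, hs]
  field_simp

end WeakType

/-! ### Almost everywhere convergence along a pseudorandom set -/

theorem exists_mem_Ico_of_strictMono {n : ℕ → ℕ} (hn : StrictMono n) {J N : ℕ} (hN : n J ≤ N) :
    ∃ j ≥ J, n j ≤ N ∧ N < n (j + 1) := by
  have hex : ∃ i, N < n i := ⟨N + 1, (Nat.lt_succ_self N).trans_le (hn.id_le _)⟩
  classical
  have h1 := Nat.find_spec hex
  have h2 : J < Nat.find hex := by
    by_contra hlt
    exact absurd (h1.trans_le (hn.monotone (not_lt.1 hlt))) (not_lt.2 hN)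
  refine ⟨Nat.find hex - 1, by omega, ?_, ?_⟩
  · exact not_lt.1 (Nat.find_min hex (by omega))
  · rwa [Nat.sub_add_cancel (by omega)]

/-- Filling the gaps of a subsequence along which the ratio of consecutive normalisations
tends to one. -/
theorem tendsto_div_zero_of_subseq {u c β : ℕ → ℝ} {K : ℝ} {n : ℕ → ℕ} (hn : StrictMono n)
    (hn0 : 0 < n 0) (hβ : ∀ N, 0 < N → 0 < β N) (hβm : Monotone β) (hcm : Monotone c)
    (hK : 0 ≤ K) (hu : ∀ M N, M ≤ N → |u N - u M| ≤ K * (c N - c M))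
    (hc : Tendsto (fun N => c N / β N) atTop (𝓝 1))
    (hratio : Tendsto (fun j => β (n (j + 1)) / β (n j)) atTop (𝓝 1))
    (hsub : Tendsto (fun j => u (n j) / β (n j)) atTop (𝓝 0)) :
    Tendsto (fun N => u N / β N) atTop (𝓝 0) := by
  have hnpos : ∀ j, 0 < n j := fun j => hn0.trans_le (hn.monotone (Nat.zero_le j))
  have hβn : ∀ j, 0 < β (n j) := fun j => hβ _ (hnpos j)
  -- Between consecutive `n j`, `u` moves by at most `K` times the increment of `c`. That increment
  -- is negligible against `β (n j)`, because `c / β` and the consecutive ratios of `β` tend to one.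
  have hw : Tendsto (fun j => |u (n j) / β (n j)| +
      K * (c (n (j + 1)) / β (n (j + 1)) * (β (n (j + 1)) / β (n j)) - c (n j) / β (n j)))
      atTop (𝓝 0) := by
    have hc1 := hc.comp (hn.tendsto_atTop.comp (tendsto_add_atTop_nat 1))
    have hc2 := hc.comp hn.tendsto_atTop
    have := hsub.abs.add (((hc1.mul hratio).sub hc2).const_mul K)
    simpa using this
  rw [Metric.tendsto_atTop] at hw ⊢
  intro ε hε
  obtain ⟨J, hJ⟩ := hw ε hε
  refine ⟨n J, fun N hN => ?_⟩
  obtain ⟨j, hj, hj1, hj2⟩ := exists_mem_Ico_of_strictMono hn hN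
  refine lt_of_le_of_lt ?_ (lt_of_abs_lt (by simpa [Real.dist_eq] using hJ j hj))
  have hNpos : 0 < β N := (hβn j).trans_le (hβm hj1)
  rw [dist_zero_right, Real.norm_eq_abs, abs_div, abs_of_pos hNpos, abs_div,
    abs_of_pos (hβn j), div_mul_div_cancel₀ (hβn (j + 1)).ne', ← sub_div, ← mul_div_assoc,
    ← add_div]
  have h1 : |u N| ≤ |u (n j)| + K * (c (n (j + 1)) - c (n j)) := by
    have h2 := hu _ _ hj1
    have h3 : K * (c N - c (n j)) ≤ K * (c (n (j + 1)) - c (n j)) := by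
      have := hcm hj2.le
      gcongr
    have h4 := abs_sub_abs_le_abs_sub (u N) (u (n j))
    linarith
  exact div_le_div₀ ((abs_nonneg _).trans h1) h1 (hβn j) (hβm hj1)

/-- By monotone convergence the pointwise series has finite integral, so it converges almost
everywhere and its terms vanish. -/
theorem ae_tendsto_zero_of_summable_integral {X : Type*} [MeasurableSpace X] {m : Measure X}
    {g : ℕ → X → ℝ} (hg : ∀ j, Integrable (g j) m) (hg0 : ∀ j x, 0 ≤ g j x)
    (hs : Summable fun j => ∫ x, g j x ∂m) :
    ∀ᵐ x ∂m, Tendsto (fun j => g j x) atTop (𝓝 0) := by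
  have h1 : ∫⁻ x, ∑' j, ENNReal.ofReal (g j x) ∂m ≠ ∞ := by
    rw [lintegral_tsum fun j => (hg j).aestronglyMeasurable.aemeasurable.ennreal_ofReal]
    simp only [← ofReal_integral_eq_lintegral_ofReal (hg _) (Eventually.of_forall (hg0 _))]
    rw [← ENNReal.ofReal_tsum_of_nonneg (fun j => integral_nonneg (hg0 j)) hs]
    exact ENNReal.ofReal_ne_top
  have h2 := ae_lt_top' (AEMeasurable.tsum fun j =>
    (hg j).aestronglyMeasurable.aemeasurable.ennreal_ofReal) h1
  filter_upwards [h2] with x hx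
  have h3 := ENNReal.tendsto_atTop_zero_of_tsum_ne_top hx.ne
  have h4 := (ENNReal.tendsto_toReal ENNReal.zero_ne_top).comp h3
  simpa [Function.comp_def, ENNReal.toReal_ofReal (hg0 _ x)] using h4

namespace IsPseudorandom

variable {a τ : ℕ → ℝ} {γ δ C : ℝ}

/-- Averages of an antitone sequence decrease. Hence the density sums grow at most in proportion to
the length, and their ratios along `(j + 1) ^ p` tend to one. -/
theorem density_mul_le (h : IsPseudorandom a τ γ δ C) {M N : ℕ} (hMN : M ≤ N) :
    (∑ k ∈ Finset.range N, τ k) * M ≤ (∑ k ∈ Finset.range M, τ k) * N := by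
  obtain ⟨d, rfl⟩ := Nat.exists_eq_add_of_le hMN
  have h1 : ∑ k ∈ Finset.range d, τ (M + k) ≤ d * τ M := by
    have := Finset.sum_le_card_nsmul (Finset.range d) (fun k => τ (M + k)) (τ M)
      fun k _ => h.antitone (Nat.le_add_right M k)
    simpa using this
  have h2 : M * τ M ≤ ∑ k ∈ Finset.range M, τ k := by
    have := Finset.card_nsmul_le_sum (Finset.range M) τ (τ M)
      fun k hk => h.antitone (Finset.mem_range.1 hk).le
    simpa using this
  rw [Finset.sum_range_add]
  push_cast
  have h3 := mul_le_mul_of_nonneg_right h1 (Nat.cast_nonneg (α := ℝ) M)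
  have h4 := mul_le_mul_of_nonneg_right h2 (Nat.cast_nonneg (α := ℝ) d)
  nlinarith

theorem sum_density_pos (h : IsPseudorandom a τ γ δ C) {N : ℕ} (hN : 0 < N) :
    0 < ∑ k ∈ Finset.range N, τ k :=
  lt_of_lt_of_le (Real.rpow_pos_of_pos (by exact_mod_cast hN) γ) (h.le_sum_density N)

theorem monotone_sum_density (h : IsPseudorandom a τ γ δ C) :
    Monotone fun N => ∑ k ∈ Finset.range N, τ k :=
  fun _ _ hMN => Finset.sum_le_sum_of_subset_of_nonneg (Finset.range_mono hMN)
    fun k _ _ => h.nonneg k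

theorem monotone_sum (h : IsPseudorandom a τ γ δ C) :
    Monotone fun N => ∑ k ∈ Finset.range N, a k :=
  fun _ _ hMN => Finset.sum_le_sum_of_subset_of_nonneg (Finset.range_mono hMN)
    fun k _ _ => h.apply_nonneg k

theorem tendsto_sum_density (h : IsPseudorandom a τ γ δ C) :
    Tendsto (fun N => ∑ k ∈ Finset.range N, τ k) atTop atTop :=
  tendsto_atTop_mono h.le_sum_density
    ((tendsto_rpow_atTop h.exponent_pos).comp tendsto_natCast_atTop_atTop)

theorem eventually_half_le_sum (h : IsPseudorandom a τ γ δ C) :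
    ∀ᶠ N : ℕ in atTop, (N : ℝ) ^ γ / 2 ≤ ∑ k ∈ Finset.range N, a k := by
  filter_upwards [h.tendsto_ratio.eventually_const_lt (show (1 / 2 : ℝ) < 1 by norm_num),
    eventually_gt_atTop 0] with N h1 h2
  rw [lt_div_iff₀ (h.sum_density_pos h2)] at h1
  linarith [h.le_sum_density N]

theorem eventually_sum_pos (h : IsPseudorandom a τ γ δ C) :
    ∀ᶠ N : ℕ in atTop, 0 < ∑ k ∈ Finset.range N, a k := by
  filter_upwards [h.eventually_half_le_sum, eventually_gt_atTop 0] with N h1 h2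
  have : 0 < (N : ℝ) ^ γ := Real.rpow_pos_of_pos (by exact_mod_cast h2) γ
  linarith

theorem tendsto_density_ratio_pow (h : IsPseudorandom a τ γ δ C) (p : ℕ) :
    Tendsto (fun j : ℕ => (∑ k ∈ Finset.range ((j + 1 + 1) ^ p), τ k) /
      ∑ k ∈ Finset.range ((j + 1) ^ p), τ k) atTop (𝓝 1) := by
  have h1 : Tendsto (fun j : ℕ => (1 + 1 / ((j : ℝ) + 1)) ^ p) atTop (𝓝 1) := by
    have := (tendsto_one_div_add_atTop_nhds_zero_nat (𝕜 := ℝ)).const_add 1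
    simpa using this.pow p
  refine tendsto_of_tendsto_of_tendsto_of_le_of_le tendsto_const_nhds h1 (fun j => ?_) fun j => ?_
  · rw [le_div_iff₀ (h.sum_density_pos (by positivity)), one_mul]
    exact h.monotone_sum_density (Nat.pow_le_pow_left (Nat.le_succ _) p)
  · show _ / _ ≤ _
    rw [div_le_iff₀ (h.sum_density_pos (by positivity))]
    have h2 := h.density_mul_le (Nat.pow_le_pow_left (Nat.le_succ (j + 1)) p)
    have h3 : (0 : ℝ) < ((j : ℝ) + 1) ^ p := by positivity
    have h4 : (1 + 1 / ((j : ℝ) + 1)) ^ p = ((j : ℝ) + 1 + 1) ^ p / ((j : ℝ) + 1) ^ p := by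
      rw [← div_pow]; congr 1; field_simp
    rw [h4, div_mul_eq_mul_div, le_div_iff₀ h3, mul_comm (((j : ℝ) + 1 + 1) ^ p)]
    exact_mod_cast h2

end IsPseudorandom

section Convergence

variable {X : Type*} [MeasurableSpace X] {m : Measure X} {T : X → X}
  {a τ : ℕ → ℝ} {γ δ C : ℝ}

/-- For a bounded function correlations are trivially at most `K ^ 2`, so no truncation is needed;
`δ ≤ γ` lets the diagonal term be absorbed into the same power saving. -/
theorem integral_sq_sum_bounded_le [IsProbabilityMeasure m] (h : IsPseudorandom a τ γ δ C)
    (hT : MeasurePreserving T m m) {g : X → ℝ} (hg : Measurable g) {K : ℝ}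
    (hK : ∀ x, |g x| ≤ K) {N : ℕ} (hN : 0 < N) :
    ∫ x, ((∑ k ∈ Finset.range N, (a k - τ k) * g (T^[k] x)) / (N : ℝ) ^ γ) ^ 2 ∂m ≤
      4 * C * K ^ 2 * (N : ℝ) ^ (-δ) := by
  have hN' : (0 : ℝ) < N := by exact_mod_cast hN
  have hN1 : (1 : ℝ) ≤ N := by exact_mod_cast hN
  have hC := h.const_nonneg
  have hcorr : ∀ d : ℕ, |∫ x, g x * g (T^[d + 1] x) ∂m| ≤ K ^ 2 := fun d => by
    have := norm_integral_le_of_norm_le_const (μ := m) (f := fun x => g x * g (T^[d + 1] x))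
      (C := K ^ 2) (Eventually.of_forall fun x => by
        rw [norm_mul, sq]
        exact mul_le_mul (hK _) (hK _) (norm_nonneg _) ((abs_nonneg _).trans (hK x)))
    simpa using this
  have hsq : ∫ x, g x ^ 2 ∂m ≤ K ^ 2 := by
    have := norm_integral_le_of_norm_le_const (μ := m) (f := fun x => g x ^ 2)
      (C := K ^ 2) (Eventually.of_forall fun x => by
        rw [norm_pow]
        exact pow_le_pow_left₀ (norm_nonneg _) (hK x) 2)
    exact (le_abs_self _).trans (by simpa using this)
  simp only [div_pow]
  rw [integral_div, div_le_iff₀ (by positivity)]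
  refine (integral_sq_weighted_sum_le hT hg hK _ (fun d hd => h.correlation_le N d hd)).trans ?_
  have h1 : ∑ d ∈ Finset.range N, |∫ x, g x * g (T^[d + 1] x) ∂m| ≤ N * K ^ 2 := by
    have := Finset.sum_le_card_nsmul (Finset.range N)
      (fun d => |∫ x, g x * g (T^[d + 1] x) ∂m|) (K ^ 2) fun d _ => hcorr d
    simpa using this
  have h2 : (N : ℝ) ^ γ ≤ (N : ℝ) ^ (-δ) * ((N : ℝ) ^ γ) ^ 2 := by
    rw [← Real.rpow_mul_natCast hN'.le, ← Real.rpow_add hN']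
    refine Real.rpow_le_rpow_of_exponent_le hN1 ?_
    push_cast
    linarith [h.saving_le]
  have h3 : (N : ℝ) ^ (2 * γ - 1 - δ) * N = (N : ℝ) ^ (-δ) * ((N : ℝ) ^ γ) ^ 2 := by
    rw [← Real.rpow_mul_natCast hN'.le, ← Real.rpow_add hN', ← Real.rpow_add_one hN'.ne']
    congr 1; push_cast; ring
  calc (∑ k ∈ Finset.range N, (a k - τ k) ^ 2) * ∫ x, g x ^ 2 ∂m +
        2 * (C * (N : ℝ) ^ (2 * γ - 1 - δ) *
          ∑ d ∈ Finset.range N, |∫ x, g x * g (T^[d + 1] x) ∂m|)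
      ≤ 2 * C * (N : ℝ) ^ γ * K ^ 2 +
        2 * (C * (N : ℝ) ^ (2 * γ - 1 - δ) * (N * K ^ 2)) := by
        gcongr
        exact h.sum_sq_le N
    _ = 2 * C * K ^ 2 * (N : ℝ) ^ γ + 2 * C * K ^ 2 * ((N : ℝ) ^ (2 * γ - 1 - δ) * N) := by ring
    _ ≤ 2 * C * K ^ 2 * ((N : ℝ) ^ (-δ) * ((N : ℝ) ^ γ) ^ 2) +
        2 * C * K ^ 2 * ((N : ℝ) ^ (-δ) * ((N : ℝ) ^ γ) ^ 2) := by
        rw [h3]; gcongr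
    _ = _ := by ring

/-- Averages of a bounded coboundary along a pseudorandom set tend to zero. -/
theorem ae_tendsto_average_coboundary [IsProbabilityMeasure m] (h : IsPseudorandom a τ γ δ C)
    (hT : MeasurePreserving T m m) {G : X → ℝ} (hG : Measurable G) {K : ℝ}
    (hK : ∀ x, |G x| ≤ K) :
    ∀ᵐ x ∂m, Tendsto (fun N => (∑ k ∈ Finset.range N, a k * (G (T^[k] x) - G (T^[k + 1] x))) /
      ∑ k ∈ Finset.range N, a k) atTop (𝓝 0) := by
  set g : X → ℝ := fun x => G x - G (T x) with hgdef
  have hgm : Measurable g := hG.sub (hG.comp hT.measurable)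
  have hgK : ∀ x, |g x| ≤ 2 * K := fun x => by
    have := abs_sub (G x) (G (T x))
    linarith [hK x, hK (T x)]
  have hgT : ∀ k x, g (T^[k] x) = G (T^[k] x) - G (T^[k + 1] x) := fun k x => by
    simp only [hgdef, Function.iterate_succ_apply']
  -- With `p * δ ≥ 2` the bound `N ^ (-δ)` at `N = (j + 1) ^ p` is at most `(j + 1) ^ (-2)`, which
  -- is summable.
  obtain ⟨p, hp⟩ := exists_nat_gt (2 / δ)
  have hδ := h.saving_pos
  have hpδ : 2 ≤ p * δ := by rw [div_lt_iff₀ hδ] at hp; exact hp.le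
  have hp0 : p ≠ 0 := by
    rintro rfl
    simp at hpδ
    linarith
  set n : ℕ → ℕ := fun j => (j + 1) ^ p with hn
  have hnpos : ∀ j, 0 < n j := fun j => by positivity
  have hnmono : StrictMono n := fun i j hij => Nat.pow_lt_pow_left (by omega) hp0
  let V : ℕ → X → ℝ := fun N x => ∑ k ∈ Finset.range N, (a k - τ k) * g (T^[k] x)
  have hVm : ∀ N, Measurable (V N) := fun N =>
    Finset.measurable_sum _ fun k _ => (hgm.comp (hT.iterate k).measurable).const_mul _
  have hVb : ∀ N x, ‖V N x‖ ≤ ∑ k ∈ Finset.range N, |a k - τ k| * (2 * K) := fun N x =>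
    norm_sum_le_of_le _ fun k _ => by
      rw [norm_mul]
      exact mul_le_mul_of_nonneg_left (hgK _) (norm_nonneg _)
  have hint : ∀ j, Integrable (fun x => (V (n j) x / (n j : ℝ) ^ γ) ^ 2) m := fun j => by
    refine Integrable.of_bound (((hVm _).div_const _).pow_const 2).aestronglyMeasurable
      (((∑ k ∈ Finset.range (n j), |a k - τ k| * (2 * K)) / (n j : ℝ) ^ γ) ^ 2)
      (Eventually.of_forall fun x => ?_)
    rw [norm_pow, norm_div, Real.norm_of_nonneg (by positivity : (0 : ℝ) ≤ (n j : ℝ) ^ γ)]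
    have := hVb (n j) x
    gcongr
  have hsum : Summable fun j => ∫ x, (V (n j) x / (n j : ℝ) ^ γ) ^ 2 ∂m := by
    have hs : Summable fun j : ℕ => 4 * C * (2 * K) ^ 2 * (1 / ((j + 1 : ℕ) : ℝ) ^ 2) :=
      (((summable_nat_add_iff 1).2 (Real.summable_one_div_nat_pow.2 one_lt_two))).mul_left _
    refine Summable.of_nonneg_of_le (fun j => integral_nonneg fun x => sq_nonneg _)
      (fun j => (integral_sq_sum_bounded_le h hT hgm hgK (hnpos j)).trans ?_) hs
    have hC := h.const_nonneg
    refine mul_le_mul_of_nonneg_left ?_ (by positivity)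
    have hj : (1 : ℝ) ≤ ((j + 1 : ℕ) : ℝ) := by exact_mod_cast Nat.le_add_left 1 j
    rw [hn, Nat.cast_pow, ← Real.rpow_natCast_mul (by positivity), one_div,
      ← Real.rpow_natCast _ 2, ← Real.rpow_neg (by positivity)]
    refine Real.rpow_le_rpow_of_exponent_le hj ?_
    push_cast
    linarith
  filter_upwards [ae_tendsto_zero_of_summable_integral hint (fun j x => sq_nonneg _) hsum]
    with x hx
  have hx1 : Tendsto (fun j => |V (n j) x| / (n j : ℝ) ^ γ) atTop (𝓝 0) := by
    have := (Real.continuous_sqrt.tendsto 0).comp hx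
    simpa only [Function.comp_def, Real.sqrt_sq_eq_abs, abs_div, Real.sqrt_zero,
      abs_of_nonneg (Real.rpow_nonneg (Nat.cast_nonneg (α := ℝ) (n _)) γ)] using this
  simp only [← hgT]
  set u : ℕ → ℝ := fun N => ∑ k ∈ Finset.range N, a k * g (T^[k] x) with hu
  have hβn : Tendsto (fun j => ∑ k ∈ Finset.range (n j), τ k) atTop atTop :=
    h.tendsto_sum_density.comp hnmono.tendsto_atTop
  have hsub : Tendsto (fun j => u (n j) / ∑ k ∈ Finset.range (n j), τ k) atTop (𝓝 0) := by
    have hlim := hx1.add (hβn.const_div_atTop (2 * K * τ 0))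
    rw [add_zero] at hlim
    refine squeeze_zero_norm (fun j => ?_) hlim
    have hpos := h.sum_density_pos (hnpos j)
    have hp2 : (0 : ℝ) < (n j : ℝ) ^ γ :=
      Real.rpow_pos_of_pos (by exact_mod_cast hnpos j) γ
    -- Here the coboundary form enters: the `τ`-part stays bounded by telescoping, while the
    -- normalisation tends to infinity.
    have hsplit : u (n j) = V (n j) x +
        ∑ k ∈ Finset.range (n j), τ k * (G (T^[k] x) - G (T^[k + 1] x)) := by
      simp only [hu, V, ← hgT]
      rw [← Finset.sum_add_distrib]
      exact Finset.sum_congr rfl fun k _ => by ring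
    have hτ := abs_sum_antitone_mul_sub_le h.antitone h.nonneg
      (u := fun k => G (T^[k] x)) (fun k => hK _) (n j)
    rw [norm_div, Real.norm_of_nonneg hpos.le, hsplit]
    calc ‖V (n j) x + ∑ k ∈ Finset.range (n j), τ k * (G (T^[k] x) - G (T^[k + 1] x))‖ /
          ∑ k ∈ Finset.range (n j), τ k
        ≤ (|V (n j) x| + 2 * K * τ 0) / ∑ k ∈ Finset.range (n j), τ k := by
          gcongr
          exact (norm_add_le _ _).trans (add_le_add le_rfl hτ)
      _ ≤ |V (n j) x| / (n j : ℝ) ^ γ + 2 * K * τ 0 / ∑ k ∈ Finset.range (n j), τ k := by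
          rw [add_div]
          gcongr
          exact h.le_sum_density _
  have hK0 : 0 ≤ 2 * K := (abs_nonneg _).trans (hgK x)
  have hfill := tendsto_div_zero_of_subseq (u := u) (c := fun N => ∑ k ∈ Finset.range N, a k)
    hnmono (hnpos 0) (fun N hN => h.sum_density_pos hN) h.monotone_sum_density h.monotone_sum
    hK0 (fun M N hMN => by
      rw [hu, ← Finset.sum_Ico_eq_sub _ hMN, ← Finset.sum_Ico_eq_sub _ hMN, Finset.mul_sum,
        ← Real.norm_eq_abs]
      refine norm_sum_le_of_le _ fun k _ => ?_
      rw [norm_mul, Real.norm_of_nonneg (h.apply_nonneg k), mul_comm]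
      exact mul_le_mul_of_nonneg_right (hgK _) (h.apply_nonneg k))
    h.tendsto_ratio (h.tendsto_density_ratio_pow p) hsub
  have hdiv := hfill.div h.tendsto_ratio one_ne_zero
  rw [zero_div] at hdiv
  refine hdiv.congr' ?_
  filter_upwards [eventually_gt_atTop 0] with N hN
  exact div_div_div_cancel_right₀ (h.sum_density_pos hN).ne' _ _

/-- Averages of an invariant function along a pseudorandom set are eventually constant. -/
theorem ae_tendsto_average_invariant (h : IsPseudorandom a τ γ δ C)
    (hT : MeasurePreserving T m m) {g : X → ℝ} (hg : (fun x => g (T x)) =ᵐ[m] g) :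
    ∀ᵐ x ∂m, Tendsto (fun N => (∑ k ∈ Finset.range N, a k * g (T^[k] x)) /
      ∑ k ∈ Finset.range N, a k) atTop (𝓝 (g x)) := by
  have h1 : ∀ᵐ x ∂m, ∀ k : ℕ, g (T (T^[k] x)) = g (T^[k] x) :=
    ae_all_iff.2 fun k => (hT.iterate k).quasiMeasurePreserving.ae hg
  filter_upwards [h1] with x hx
  have hx2 : ∀ k, g (T^[k] x) = g x := by
    intro k
    induction k with
    | zero => rfl
    | succ k ih => rw [Function.iterate_succ_apply', hx, ih]
  refine tendsto_const_nhds.congr' ?_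
  filter_upwards [h.eventually_sum_pos] with N hN
  simp only [hx2]
  rw [← Finset.sum_mul, mul_div_assoc, mul_comm, div_mul_cancel₀ _ hN.ne']

end Convergence

/-! ### Decomposition into invariant, coboundary and small parts -/

section Decomposition

variable {X : Type*} [MeasurableSpace X] {m : Measure X} {T : X → X}

/-- A Birkhoff average differs from the function by a coboundary of a bounded function. -/
theorem exists_coboundary_eq_sub_average {X : Type*} [MeasurableSpace X] {T : X → X}
    (hT : Measurable T) {f : X → ℝ} (hf : Measurable f) {K : ℝ} (hK : ∀ x, |f x| ≤ K) {n : ℕ}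
    (hn : 0 < n) :
    ∃ (G : X → ℝ) (K' : ℝ), Measurable G ∧ (∀ x, |G x| ≤ K') ∧
      ∀ x, G x - G (T x) = f x - (n : ℝ)⁻¹ * ∑ k ∈ Finset.range n, f (T^[k] x) := by
  have hn' : (n : ℝ) ≠ 0 := by exact_mod_cast hn.ne'
  -- The witness averages the Birkhoff sums `S_k` over `k < n`, since `S_k - S_k ∘ T = f - f ∘
  -- T^[k]`.
  refine ⟨fun x => (n : ℝ)⁻¹ * ∑ k ∈ Finset.range n, ∑ i ∈ Finset.range k, f (T^[i] x),
    (n : ℝ)⁻¹ * ∑ k ∈ Finset.range n, ∑ i ∈ Finset.range k, K, ?_, fun x => ?_, fun x => ?_⟩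
  · exact (Finset.measurable_sum _ fun k _ => Finset.measurable_sum _ fun i _ =>
      hf.comp (hT.iterate i)).const_mul _
  · rw [abs_mul, abs_of_nonneg (by positivity : (0 : ℝ) ≤ (n : ℝ)⁻¹)]
    gcongr
    refine (Finset.abs_sum_le_sum_abs _ _).trans (Finset.sum_le_sum fun k _ => ?_)
    exact (Finset.abs_sum_le_sum_abs _ _).trans (Finset.sum_le_sum fun i _ => hK _)
  · have h1 : ∀ k, ∑ i ∈ Finset.range k, f (T^[i] x) - ∑ i ∈ Finset.range k, f (T^[i] (T x)) =
        f x - f (T^[k] x) := fun k => by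
      rw [← Finset.sum_sub_distrib]
      exact Finset.sum_range_sub' (fun i => f (T^[i] x)) k
    rw [← mul_sub, ← Finset.sum_sub_distrib, Finset.sum_congr rfl fun k _ => h1 k,
      Finset.sum_sub_distrib, mul_sub]
    congr 1
    simp [hn']

/-- The mean ergodic theorem, for a bounded function. -/
theorem exists_invariant_eLpNorm_average_sub_lt [IsProbabilityMeasure m]
    (hT : MeasurePreserving T m m) {f : X → ℝ} (hf : Measurable f) {K : ℝ}
    (hK : ∀ x, |f x| ≤ K) {ε : ℝ≥0∞} (hε : 0 < ε) :
    ∃ (g : X → ℝ) (n : ℕ), Measurable g ∧ (fun x => g (T x)) =ᵐ[m] g ∧ 0 < n ∧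
      eLpNorm (fun x => (n : ℝ)⁻¹ * ∑ k ∈ Finset.range n, f (T^[k] x) - g x) 1 m < ε := by
  have hfL : MemLp f 2 m := MemLp.of_bound hf.aestronglyMeasurable K (Eventually.of_forall hK)
  let U : Lp ℝ 2 m →L[ℝ] Lp ℝ 2 m :=
    (Lp.compMeasurePreservingₗᵢ ℝ T hT).toContinuousLinearMap
  have hU : ‖U‖ ≤ 1 := LinearIsometry.norm_toContinuousLinearMap_le _
  have hconv := U.tendsto_birkhoffAverage_orthogonalProjection hU (hfL.toLp f)
  set F : Lp ℝ 2 m := ((U.eqLocus (1 : Lp ℝ 2 m →L[ℝ] Lp ℝ 2 m)).orthogonalProjectionOnto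
    (hfL.toLp f) : Lp ℝ 2 m) with hF
  have hUF : U F = F :=
    ((U.eqLocus (1 : Lp ℝ 2 m →L[ℝ] Lp ℝ 2 m)).orthogonalProjectionOnto (hfL.toLp f)).2
  have hinv : (fun x => F (T x)) =ᵐ[m] F := by
    have h1 : (U F : X → ℝ) =ᵐ[m] F ∘ T := Lp.coeFn_compMeasurePreserving F hT
    rw [hUF] at h1
    exact h1.symm
  have hiter : ∀ k : ℕ, U^[k] (hfL.toLp f) =
      (hfL.comp_measurePreserving (hT.iterate k)).toLp (f ∘ T^[k]) := by
    intro k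
    have h1 : U^[k] (hfL.toLp f) = Lp.compMeasurePreserving T^[k] (hT.iterate k) (hfL.toLp f) := by
      rw [← Lp.compMeasurePreserving_iterate]
      rfl
    rw [h1, Lp.toLp_compMeasurePreserving]
  have hcoe : ∀ n : ℕ, ((birkhoffAverage ℝ U _root_.id n (hfL.toLp f) : Lp ℝ 2 m) : X → ℝ) =ᵐ[m]
      fun x => (n : ℝ)⁻¹ * ∑ k ∈ Finset.range n, f (T^[k] x) := by
    intro n
    have h1 : birkhoffAverage ℝ U _root_.id n (hfL.toLp f) =
        (n : ℝ)⁻¹ • ∑ k ∈ Finset.range n,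
          (hfL.comp_measurePreserving (hT.iterate k)).toLp (f ∘ T^[k]) := by
      simp only [birkhoffAverage, birkhoffSum, _root_.id, hiter]
    rw [h1]
    have h2 : ∀ᵐ x ∂m, ∀ k : ℕ,
        ((hfL.comp_measurePreserving (hT.iterate k)).toLp (f ∘ T^[k]) : X → ℝ) x =
          f (T^[k] x) :=
      ae_all_iff.2 fun k => (hfL.comp_measurePreserving (hT.iterate k)).coeFn_toLp
    filter_upwards [h2, Lp.coeFn_smul (n : ℝ)⁻¹ (∑ k ∈ Finset.range n,
        (hfL.comp_measurePreserving (hT.iterate k)).toLp (f ∘ T^[k])),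
      Lp.coeFn_finsetSum (Finset.range n)
        fun k => (hfL.comp_measurePreserving (hT.iterate k)).toLp (f ∘ T^[k])] with x hx1 hx2 hx3
    rw [hx2, Pi.smul_apply, hx3, smul_eq_mul, Finset.sum_apply]
    simp only [hx1]
  have hedist : Tendsto (fun n => edist (birkhoffAverage ℝ U _root_.id n (hfL.toLp f)) F) atTop
      (𝓝 0) := tendsto_iff_edist_tendsto_0.1 hconv
  obtain ⟨n, hn1, hn2⟩ := ((hedist.eventually_lt_const hε).and (eventually_gt_atTop 0)).exists
  refine ⟨F, n, (Lp.stronglyMeasurable F).measurable, hinv, hn2, ?_⟩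
  rw [Lp.edist_def] at hn1
  have hcongr : (fun x => (n : ℝ)⁻¹ * ∑ k ∈ Finset.range n, f (T^[k] x) - F x) =ᵐ[m]
      ((birkhoffAverage ℝ U _root_.id n (hfL.toLp f) : Lp ℝ 2 m) : X → ℝ) - F := by
    filter_upwards [hcoe n] with x hx
    rw [Pi.sub_apply, hx]
  rw [eLpNorm_congr_ae hcongr]
  refine lt_of_le_of_lt (eLpNorm_le_eLpNorm_of_exponent_le one_le_two ?_) hn1
  exact ((Lp.aestronglyMeasurable _).sub (Lp.aestronglyMeasurable _))

/-- Every integrable function is the sum of an invariant function, a bounded coboundary, and a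
function of small `L¹` norm. -/
theorem exists_invariant_add_coboundary_add_small [IsProbabilityMeasure m]
    (hT : MeasurePreserving T m m) {f : X → ℝ} (hf : Measurable f) (hfi : Integrable f m)
    {ε : ℝ} (hε : 0 < ε) :
    ∃ (g G r : X → ℝ) (K : ℝ), (fun x => g (T x)) =ᵐ[m] g ∧
      Measurable G ∧ (∀ x, |G x| ≤ K) ∧ Measurable r ∧ Integrable r m ∧ ∫ x, |r x| ∂m ≤ ε ∧
      ∀ x, f x = g x + (G x - G (T x)) + r x := by
  have hε2 : ENNReal.ofReal (ε / 2) ≠ 0 := by simpa using hε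
  -- With `s` simple and `A` its Birkhoff average, `f = g + (s - A) + ((f - s) + (A - g))`: the
  -- middle term is a bounded coboundary and each piece of the last has norm below `ε / 2`.
  obtain ⟨s, hs, -⟩ := (memLp_one_iff_integrable.2 hfi).exists_simpleFunc_eLpNorm_sub_lt
    ENNReal.one_ne_top hε2
  obtain ⟨K, hK⟩ := s.exists_forall_norm_le
  obtain ⟨g, n, hgm, hg, hn, hgn⟩ := exists_invariant_eLpNorm_average_sub_lt hT s.measurable hK
    (pos_iff_ne_zero.2 hε2)
  obtain ⟨G, K', hGm, hG, hGs⟩ :=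
    exists_coboundary_eq_sub_average hT.measurable s.measurable hK hn
  have hA : Measurable fun x => (n : ℝ)⁻¹ * ∑ k ∈ Finset.range n, s (T^[k] x) :=
    (Finset.measurable_sum _ fun k _ =>
      s.measurable.comp (hT.iterate k).measurable).const_mul _
  set r : X → ℝ := (f - s) +
    fun x => (n : ℝ)⁻¹ * ∑ k ∈ Finset.range n, s (T^[k] x) - g x with hr
  have hrm : Measurable r := (hf.sub s.measurable).add (hA.sub hgm)
  have hrn : eLpNorm r 1 m ≤ ENNReal.ofReal ε := by
    refine (eLpNorm_add_le (hf.sub s.measurable).aestronglyMeasurable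
      (hA.sub hgm).aestronglyMeasurable le_rfl).trans ?_
    refine (add_le_add hs.le hgn.le).trans (le_of_eq ?_)
    rw [← ENNReal.ofReal_add (by positivity) (by positivity), add_halves]
  have hri : Integrable r m :=
    memLp_one_iff_integrable.1 ⟨hrm.aestronglyMeasurable, hrn.trans_lt ENNReal.ofReal_lt_top⟩
  refine ⟨g, G, r, K', hg, hGm, hG, hrm, hri, ?_, fun x => ?_⟩
  · have h1 : ∫ x, |r x| ∂m = (eLpNorm r 1 m).toReal := by
      rw [eLpNorm_one_eq_lintegral_enorm, ← integral_norm_eq_lintegral_enorm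
        hrm.aestronglyMeasurable]
      rfl
    rw [h1]
    exact ENNReal.toReal_le_of_le_ofReal hε.le hrn
  · rw [hGs x, hr, Pi.add_apply, Pi.sub_apply]
    ring

end Decomposition

/-! ### Pointwise convergence for integrable functions -/

section PointwiseConvergence

variable {X : Type*} [MeasurableSpace X] {m : Measure X} {T : X → X}
  {a τ : ℕ → ℝ} {γ δ C : ℝ}

/-- Banach principle: up to a null set, oscillation by `ε` forces the remainder `r` into the
exceptional set of the maximal inequality, whose measure is a multiple of `∫ |r|`. The remainder
being arbitrarily small, the bad set is null. -/
theorem ae_exists_forall_ge_abs_average_sub_lt [IsProbabilityMeasure m]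
    (h : IsPseudorandom a τ γ δ C) (hT : MeasurePreserving T m m) {f : X → ℝ}
    (hf : Measurable f) (hfi : Integrable f m) {ε : ℝ} (hε : 0 < ε) :
    ∀ᵐ x ∂m, ∃ M, ∀ N ≥ M, ∀ N' ≥ M,
      |(∑ k ∈ Finset.range N, a k * f (T^[k] x)) / ∑ k ∈ Finset.range N, a k -
        (∑ k ∈ Finset.range N', a k * f (T^[k] x)) / ∑ k ∈ Finset.range N', a k| < ε := by
  set A : (X → ℝ) → ℕ → X → ℝ := fun f N x =>
    (∑ k ∈ Finset.range N, a k * f (T^[k] x)) / ∑ k ∈ Finset.range N, a k with hA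
  -- Since eventually `∑ a ≥ N ^ γ / 2`, height `ε / 8` relative to `N ^ γ` means remainder averages
  -- of at most `ε / 4`.
  set K₀ : ℝ := weakTypeConst γ δ C * ((C + 1) * 2 ^ γ) / (ε / 8) with hK₀
  rw [ae_iff]
  set bad : Set X := {x | ¬∃ M, ∀ N ≥ M, ∀ N' ≥ M, |A f N x - A f N' x| < ε} with hbad
  have key : ∀ η : ℝ, 0 < η → m bad ≤ ENNReal.ofReal (|K₀| * η) := by
    intro η hη
    obtain ⟨g, G, r, K, hg, hGm, hG, hrm, hri, hrη, hdec⟩ :=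
      exists_invariant_add_coboundary_add_small hT hf hfi hη
    have hAf : ∀ N x, A f N x = A g N x +
        (∑ k ∈ Finset.range N, a k * (G (T^[k] x) - G (T^[k + 1] x))) /
          (∑ k ∈ Finset.range N, a k) + A r N x := by
      intro N x
      simp only [hA, ← add_div, ← Finset.sum_add_distrib]
      congr 1
      refine Finset.sum_congr rfl fun k _ => ?_
      rw [hdec (T^[k] x), ← Function.iterate_succ_apply' T k x]
      ring
    have hsub : bad ≤ᵐ[m] {x | ∃ N : ℕ, 1 ≤ N ∧ ε / 8 * (N : ℝ) ^ γ <
        ∑ k ∈ Finset.range N, a k * |r (T^[k] x)|} := by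
      filter_upwards [ae_tendsto_average_coboundary h hT hGm hG,
        ae_tendsto_average_invariant h hT hg] with x hx1 hx2 hxbad
      by_contra hx3
      have hx3' : ∀ N : ℕ, 1 ≤ N →
          ∑ k ∈ Finset.range N, a k * |r (T^[k] x)| ≤ ε / 8 * (N : ℝ) ^ γ := by
        intro N hN
        by_contra hlt
        exact hx3 ⟨N, hN, not_le.1 hlt⟩
      refine hxbad ?_
      have hcau := (hx2.add hx1).cauchySeq
      obtain ⟨M₁, hM₁⟩ := Metric.cauchySeq_iff.1 hcau (ε / 4) (by positivity)
      obtain ⟨M₂, hM₂⟩ := eventually_atTop.1 h.eventually_half_le_sum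
      have hr : ∀ N ≥ max M₂ 1, |A r N x| ≤ ε / 4 := by
        intro N hN
        have hN1 : 1 ≤ N := (le_max_right _ _).trans hN
        have hN2 := hM₂ N ((le_max_left _ _).trans hN)
        have hNpos : (0 : ℝ) < (N : ℝ) ^ γ := Real.rpow_pos_of_pos (by exact_mod_cast hN1) γ
        have hcpos : 0 < ∑ k ∈ Finset.range N, a k := by linarith
        rw [hA, abs_div, abs_of_pos hcpos, div_le_iff₀ hcpos]
        have h1 : |∑ k ∈ Finset.range N, a k * r (T^[k] x)| ≤
            ∑ k ∈ Finset.range N, a k * |r (T^[k] x)| :=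
          (Finset.abs_sum_le_sum_abs _ _).trans (le_of_eq (Finset.sum_congr rfl fun k _ => by
            rw [abs_mul, abs_of_nonneg (h.apply_nonneg k)]))
        nlinarith [hx3' N hN1]
      refine ⟨max M₁ (max M₂ 1), fun N hN N' hN' => ?_⟩
      have h1 := hM₁ N ((le_max_left _ _).trans hN) N' ((le_max_left _ _).trans hN')
      have h2 := abs_le.1 (hr N ((le_max_right _ _).trans hN))
      have h3 := abs_le.1 (hr N' ((le_max_right _ _).trans hN'))
      rw [Real.dist_eq, abs_lt] at h1
      rw [hAf, hAf, abs_lt]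
      constructor <;> linarith [h1.1, h1.2]
    refine (measure_mono_ae hsub).trans ?_
    refine (measure_exists_weighted_sum_gt_le h hT (f := fun x => |r x|) hrm.abs hri.abs
      (fun x => abs_nonneg _) (by positivity : 0 < ε / 8)).trans ?_
    refine ENNReal.ofReal_le_ofReal ?_
    rw [← hK₀]
    exact mul_le_mul (le_abs_self _) hrη (integral_nonneg fun x => abs_nonneg _) (abs_nonneg _)
  have hlim : Tendsto (fun n : ℕ => ENNReal.ofReal (|K₀| * (1 / ((n : ℝ) + 1)))) atTop (𝓝 0) := by
    have := ENNReal.tendsto_ofReal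
      ((tendsto_one_div_add_atTop_nhds_zero_nat (𝕜 := ℝ)).const_mul |K₀|)
    simpa using this
  exact le_antisymm (ge_of_tendsto' hlim fun n => key _ (by positivity)) zero_le

theorem ae_exists_tendsto_average_real [IsProbabilityMeasure m]
    (h : IsPseudorandom a τ γ δ C) (hT : MeasurePreserving T m m) {f : X → ℝ}
    (hfi : Integrable f m) :
    ∀ᵐ x ∂m, ∃ L : ℝ, Tendsto (fun N => (∑ k ∈ Finset.range N, a k * f (T^[k] x)) /
      ∑ k ∈ Finset.range N, a k) atTop (𝓝 L) := by
  obtain ⟨f', hf'm, hff'⟩ := hfi.aestronglyMeasurable.aemeasurable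
  have hiter : ∀ᵐ x ∂m, ∀ k : ℕ, f (T^[k] x) = f' (T^[k] x) :=
    ae_all_iff.2 fun k => (hT.iterate k).quasiMeasurePreserving.ae hff'
  have hclose : ∀ᵐ x ∂m, ∀ n : ℕ, ∃ M, ∀ N ≥ M, ∀ N' ≥ M,
      |(∑ k ∈ Finset.range N, a k * f' (T^[k] x)) / ∑ k ∈ Finset.range N, a k -
        (∑ k ∈ Finset.range N', a k * f' (T^[k] x)) / ∑ k ∈ Finset.range N', a k| <
          1 / ((n : ℝ) + 1) :=
    ae_all_iff.2 fun n => ae_exists_forall_ge_abs_average_sub_lt h hT hf'm (hfi.congr hff')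
      (by positivity)
  filter_upwards [hiter, hclose] with x hx1 hx2
  simp only [hx1]
  refine cauchySeq_tendsto_of_complete (Metric.cauchySeq_iff.2 fun ε hε => ?_)
  obtain ⟨n, hn⟩ := exists_nat_one_div_lt hε
  obtain ⟨M, hM⟩ := hx2 n
  exact ⟨M, fun N hN N' hN' => (hM N hN N' hN').trans hn⟩

/-- The pointwise ergodic theorem along a pseudorandom set. -/
theorem ae_exists_tendsto_average [IsProbabilityMeasure m]
    (h : IsPseudorandom a τ γ δ C) (hT : MeasurePreserving T m m) {f : X → ℂ}
    (hf : MemLp f 1 m) :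
    ∀ᵐ x ∂m, ∃ L : ℂ, Tendsto (fun N => (∑ k ∈ Finset.range N, (a k : ℂ) * f (T^[k] x)) /
      ((∑ k ∈ Finset.range N, a k : ℝ) : ℂ)) atTop (𝓝 L) := by
  have hfi := memLp_one_iff_integrable.1 hf
  filter_upwards [ae_exists_tendsto_average_real h hT hfi.re,
    ae_exists_tendsto_average_real h hT hfi.im] with x ⟨L₁, hL₁⟩ ⟨L₂, hL₂⟩
  refine ⟨L₁ + L₂ * Complex.I, ?_⟩
  have h1 := (Complex.continuous_ofReal.tendsto L₁).comp hL₁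
  have h2 := ((Complex.continuous_ofReal.tendsto L₂).comp hL₂).mul_const Complex.I
  refine (h1.add h2).congr fun N => ?_
  simp only [Function.comp_apply, Complex.ofReal_div, div_mul_eq_mul_div, ← add_div]
  congr 1
  rw [Complex.ofReal_sum, Complex.ofReal_sum, Finset.sum_mul, ← Finset.sum_add_distrib]
  refine Finset.sum_congr rfl fun k _ => ?_
  rw [Complex.ofReal_mul, Complex.ofReal_mul, mul_assoc, ← mul_add]
  congr 1
  exact Complex.re_add_im _

end PointwiseConvergence

/-! ### Random sequences are pseudorandom -/

section Tail

variable {Ω : Type*} [MeasurableSpace Ω] {P : Measure Ω} [IsProbabilityMeasure P]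

theorem integrable_of_abs_le_one {Z : Ω → ℝ} (hZ : Measurable Z) (hZ1 : ∀ ω, |Z ω| ≤ 1) :
    Integrable Z P :=
  Integrable.of_bound hZ.aestronglyMeasurable 1 (Eventually.of_forall hZ1)

/-- Integrate `exp x ≤ 1 + x + x ^ 2`, valid for `|x| ≤ 1`; the linear term has mean zero. -/
theorem mgf_le_exp_of_abs_le_one {Z : Ω → ℝ} (hZ : Measurable Z) (hZ1 : ∀ ω, |Z ω| ≤ 1)
    (hZ0 : ∫ ω, Z ω ∂P = 0) {θ : ℝ} (hθ : |θ| ≤ 1) :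
    mgf Z P θ ≤ Real.exp (θ ^ 2 * ∫ ω, Z ω ^ 2 ∂P) := by
  have hi1 : Integrable Z P := integrable_of_abs_le_one hZ hZ1
  have hi2 : Integrable (fun ω => Z ω ^ 2) P :=
    integrable_of_abs_le_one (hZ.pow_const 2) fun ω => by
      rw [abs_pow]; exact pow_le_one₀ (abs_nonneg _) (hZ1 ω)
  have hb : ∀ ω, Real.exp (θ * Z ω) ≤ 1 + θ * Z ω + θ ^ 2 * Z ω ^ 2 := by
    intro ω
    have h1 : |θ * Z ω| ≤ 1 := by
      rw [abs_mul]; exact mul_le_one₀ hθ (abs_nonneg _) (hZ1 ω)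
    have h2 := (abs_le.1 (Real.abs_exp_sub_one_sub_id_le h1)).2
    rw [mul_pow] at h2
    linarith
  have hi3 : Integrable (fun ω => 1 + θ * Z ω + θ ^ 2 * Z ω ^ 2) P :=
    ((integrable_const 1).add (hi1.const_mul θ)).add (hi2.const_mul _)
  calc mgf Z P θ ≤ ∫ ω, (1 + θ * Z ω + θ ^ 2 * Z ω ^ 2) ∂P :=
        integral_mono_of_nonneg (Eventually.of_forall fun ω => (Real.exp_pos _).le) hi3
          (Eventually.of_forall hb)
    _ = 1 + θ ^ 2 * ∫ ω, Z ω ^ 2 ∂P := by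
        have hi4 : Integrable (fun ω => 1 + θ * Z ω) P :=
          (integrable_const 1).add (hi1.const_mul θ)
        rw [integral_add hi4 (hi2.const_mul _),
          integral_add (integrable_const 1) (hi1.const_mul θ), integral_const_mul,
          integral_const_mul, hZ0]
        simp
    _ ≤ _ := by linarith [Real.add_one_le_exp (θ ^ 2 * ∫ ω, Z ω ^ 2 ∂P)]

variable {ι : Type*} {Z : ι → Ω → ℝ}

/-- Independence is asked only of one term against sums of others inside `s`. This weak form suits
products `Y k * Y (k + d)`, which can share factors unless the indices are restricted. -/
theorem mgf_sum_le_exp [DecidableEq ι] (hZ : ∀ i, Measurable (Z i)) (hZ1 : ∀ i ω, |Z i ω| ≤ 1)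
    (hZ0 : ∀ i, ∫ ω, Z i ω ∂P = 0) (s : Finset ι)
    (hind : ∀ i t, i ∉ t → insert i t ⊆ s → IndepFun (Z i) (fun ω => ∑ j ∈ t, Z j ω) P)
    {θ : ℝ} (hθ : |θ| ≤ 1) :
    mgf (fun ω => ∑ j ∈ s, Z j ω) P θ ≤ Real.exp (θ ^ 2 * ∑ j ∈ s, ∫ ω, Z j ω ^ 2 ∂P) := by
  induction s using Finset.induction_on with
  | empty => simp [mgf]
  | insert i t hit ih =>
    have h1 : (fun ω => ∑ j ∈ insert i t, Z j ω) = Z i + fun ω => ∑ j ∈ t, Z j ω := by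
      ext ω; rw [Finset.sum_insert hit]; rfl
    have hm : Measurable fun ω => ∑ j ∈ t, Z j ω := Finset.measurable_sum _ fun j _ => hZ j
    rw [h1, (hind i t hit subset_rfl).mgf_add
      ((hZ i).const_mul θ).exp.aestronglyMeasurable (hm.const_mul θ).exp.aestronglyMeasurable,
      Finset.sum_insert hit, mul_add, Real.exp_add]
    refine mul_le_mul (mgf_le_exp_of_abs_le_one (hZ i) (hZ1 i) (hZ0 i) hθ) (ih ?_) mgf_nonneg
      (Real.exp_pos _).le
    exact fun j u hju hsub => hind j u hju (hsub.trans (Finset.subset_insert i t))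

/-- An exponential tail bound for sums of independent bounded centered random variables. -/
theorem measureReal_abs_sum_ge_le [DecidableEq ι] (hZ : ∀ i, Measurable (Z i))
    (hZ1 : ∀ i ω, |Z i ω| ≤ 1) (hZ0 : ∀ i, ∫ ω, Z i ω ∂P = 0) (s : Finset ι)
    (hind : ∀ i t, i ∉ t → insert i t ⊆ s → IndepFun (Z i) (fun ω => ∑ j ∈ t, Z j ω) P)
    {V : ℝ} (hV : 1 ≤ V) (hsV : ∑ j ∈ s, ∫ ω, Z j ω ^ 2 ∂P ≤ V) (t : ℝ) :
    P.real {ω | √V * t ≤ |∑ j ∈ s, Z j ω|} ≤ 2 * Real.exp (1 - t) := by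
  have hV0 : 0 < √V := Real.sqrt_pos.2 (by linarith)
  -- This choice keeps the exponent `θ ^ 2 * V` at one, and `V ≥ 1` ensures `θ ≤ 1`.
  set θ : ℝ := (√V)⁻¹ with hθ
  have hθ0 : 0 < θ := by positivity
  have hθ1 : |θ| ≤ 1 := by
    rw [abs_of_pos hθ0]
    exact inv_le_one_of_one_le₀ (Real.one_le_sqrt.2 hV)
  have hθV : θ ^ 2 * ∑ j ∈ s, ∫ ω, Z j ω ^ 2 ∂P ≤ 1 := by
    rw [hθ, inv_pow, Real.sq_sqrt (by linarith), inv_mul_le_iff₀ (by linarith), mul_one]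
    exact hsV
  have hm : Measurable fun ω => ∑ j ∈ s, Z j ω := Finset.measurable_sum _ fun j _ => hZ j
  have hbd : ∀ ω, |∑ j ∈ s, Z j ω| ≤ s.card := fun ω =>
    (Finset.abs_sum_le_sum_abs _ _).trans
      ((Finset.sum_le_card_nsmul _ _ 1 fun j _ => hZ1 j ω).trans (by simp))
  have hint : ∀ r : ℝ, Integrable (fun ω => Real.exp (r * ∑ j ∈ s, Z j ω)) P := fun r => by
    refine Integrable.of_bound (hm.const_mul r).exp.aestronglyMeasurable
      (Real.exp (|r| * s.card)) (Eventually.of_forall fun ω => ?_)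
    rw [Real.norm_of_nonneg (Real.exp_pos _).le, Real.exp_le_exp]
    refine (le_abs_self _).trans ?_
    rw [abs_mul]
    exact mul_le_mul_of_nonneg_left (hbd ω) (abs_nonneg _)
  have hmgf : ∀ r : ℝ, |r| ≤ 1 → r ^ 2 = θ ^ 2 →
      mgf (fun ω => ∑ j ∈ s, Z j ω) P r ≤ Real.exp 1 := fun r hr hr2 =>
    (mgf_sum_le_exp hZ hZ1 hZ0 s hind hr).trans (Real.exp_le_exp.2 (by rw [hr2]; exact hθV))
  have hθt : θ * (√V * t) = t := by rw [hθ, inv_mul_cancel_left₀ hV0.ne']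
  have hup : P.real {ω | √V * t ≤ ∑ j ∈ s, Z j ω} ≤ Real.exp (1 - t) := by
    refine (measure_ge_le_exp_mul_mgf (√V * t) hθ0.le (hint θ)).trans ?_
    rw [neg_mul, hθt, sub_eq_neg_add, Real.exp_add]
    exact mul_le_mul_of_nonneg_left (hmgf θ hθ1 rfl) (Real.exp_pos _).le
  have hdown : P.real {ω | ∑ j ∈ s, Z j ω ≤ -(√V * t)} ≤ Real.exp (1 - t) := by
    refine (measure_le_le_exp_mul_mgf (-(√V * t)) (neg_nonpos.2 hθ0.le) (hint (-θ))).trans ?_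
    rw [neg_neg, mul_neg, hθt, sub_eq_neg_add, Real.exp_add]
    exact mul_le_mul_of_nonneg_left (hmgf (-θ) (by rwa [abs_neg]) (by ring)) (Real.exp_pos _).le
  have hsub : {ω | √V * t ≤ |∑ j ∈ s, Z j ω|} ⊆
      {ω | √V * t ≤ ∑ j ∈ s, Z j ω} ∪ {ω | ∑ j ∈ s, Z j ω ≤ -(√V * t)} := by
    intro ω hω
    rcases le_abs.1 (show √V * t ≤ |∑ j ∈ s, Z j ω| from hω) with h | h
    · exact Or.inl h
    · exact Or.inr (show ∑ j ∈ s, Z j ω ≤ -(√V * t) by linarith)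
  refine (measureReal_mono hsub).trans ((measureReal_union_le _ _).trans ?_)
  linarith

end Tail

/-! ### Autocorrelations of independent variables -/

section Correlation

variable {Ω : Type*} [MeasurableSpace Ω] {P : Measure Ω} {Y : ℕ → Ω → ℝ}

/-- The products `Y k * Y (k + d)` with the integer part of `k / d` of a fixed parity involve
disjoint pairs of indices. -/
theorem indepFun_mul_shift_sum (hY : ∀ k, Measurable (Y k)) (hind : iIndepFun Y P) {d : ℕ}
    (hd : 0 < d) {e i : ℕ} {t : Finset ℕ} (hit : i ∉ t) (hi : (i / d) % 2 = e)
    (ht : ∀ j ∈ t, (j / d) % 2 = e) :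
    IndepFun (fun ω => Y i ω * Y (i + d) ω) (fun ω => ∑ j ∈ t, Y j ω * Y (j + d) ω) P := by
  classical
  -- Shifting by `d` moves to the next block of length `d` and flips the parity, so a base index of
  -- one product is never the shifted index of another.
  let A : Finset ℕ := {i, i + d}
  let B : Finset ℕ := t ∪ t.image (· + d)
  have hdiv : ∀ j, (j + d) / d = j / d + 1 := fun j => Nat.add_div_right j hd
  have hAB : Disjoint A B := by
    rw [Finset.disjoint_left]
    intro x hxA hxB
    simp only [A, B, Finset.mem_insert, Finset.mem_singleton, Finset.mem_union,
      Finset.mem_image] at hxA hxB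
    rcases hxA with rfl | rfl
    · rcases hxB with h | ⟨j, hj, rfl⟩
      · exact hit h
      · have := ht j hj
        rw [hdiv] at hi
        omega
    · rcases hxB with h | ⟨j, hj, hji⟩
      · have := ht _ h
        rw [hdiv] at this
        omega
      · exact hit (by rwa [← Nat.add_right_cancel hji])
  have hA1 : i ∈ A := by simp [A]
  have hA2 : i + d ∈ A := by simp [A]
  have hB1 : ∀ j ∈ t, j ∈ B := fun j hj => Finset.mem_union_left _ hj
  have hB2 : ∀ j ∈ t, j + d ∈ B := fun j hj =>
    Finset.mem_union_right _ (Finset.mem_image_of_mem _ hj)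
  have h := hind.indepFun_finset A B hAB hY
  have hφ : Measurable fun v : A → ℝ => v ⟨i, hA1⟩ * v ⟨i + d, hA2⟩ :=
    (measurable_pi_apply _).mul (measurable_pi_apply _)
  have hψ : Measurable fun v : B → ℝ =>
      ∑ j ∈ t.attach, v ⟨j, hB1 j j.2⟩ * v ⟨j + d, hB2 j j.2⟩ :=
    Finset.measurable_sum _ fun j _ => (measurable_pi_apply _).mul (measurable_pi_apply _)
  have h2 := h.comp hφ hψ
  convert h2 using 1
  · rfl
  ext ω
  exact (Finset.sum_attach t fun j => Y j ω * Y (j + d) ω).symm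

/-- Each parity class of `k / d` obeys the exponential tail bound, with variances at most `τ k * τ
(k + d) ≤ τ k ^ 2`. Adding the two classes doubles both threshold and probability. -/
theorem measureReal_correlation_ge_le [IsProbabilityMeasure P] (hY : ∀ k, Measurable (Y k))
    (hind : iIndepFun Y P)
    (hY1 : ∀ k ω, |Y k ω| ≤ 1) (hY0 : ∀ k, ∫ ω, Y k ω ∂P = 0) {τ : ℕ → ℝ} (hτ : Antitone τ)
    (hτ0 : ∀ k, 0 ≤ τ k) (hvar : ∀ k, ∫ ω, Y k ω ^ 2 ∂P ≤ τ k) {d : ℕ} (hd : 0 < d) (n : ℕ)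
    {V : ℝ} (hV : 1 ≤ V) (hsV : ∑ k ∈ Finset.range n, τ k ^ 2 ≤ V) (t : ℝ) :
    P.real {ω | 2 * (√V * t) ≤ |∑ k ∈ Finset.range n, Y k ω * Y (k + d) ω|} ≤
      4 * Real.exp (1 - t) := by
  have hindk : ∀ k, IndepFun (Y k) (Y (k + d)) P := fun k => hind.indepFun (by omega)
  have hZ0 : ∀ k, ∫ ω, Y k ω * Y (k + d) ω ∂P = 0 := fun k => by
    have := (hindk k).integral_mul_eq_mul_integral (hY k).aestronglyMeasurable
      (hY (k + d)).aestronglyMeasurable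
    rw [hY0, zero_mul] at this
    exact this
  have hZ2 : ∀ k, ∫ ω, (Y k ω * Y (k + d) ω) ^ 2 ∂P ≤ τ k ^ 2 := fun k => by
    have h1 : IndepFun (fun ω => Y k ω ^ 2) (fun ω => Y (k + d) ω ^ 2) P :=
      (hindk k).comp (measurable_id.pow_const 2) (measurable_id.pow_const 2)
    have h2 := h1.integral_mul_eq_mul_integral ((hY k).pow_const 2).aestronglyMeasurable
      ((hY (k + d)).pow_const 2).aestronglyMeasurable
    simp only [mul_pow]
    refine (le_of_eq h2).trans ?_
    rw [sq]
    exact mul_le_mul (hvar k) ((hvar _).trans (hτ (Nat.le_add_right k d)))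
      (integral_nonneg fun ω => sq_nonneg _) (hτ0 k)
  have hpar : ∀ e : ℕ, P.real {ω | √V * t ≤
      |∑ k ∈ Finset.range n with (k / d) % 2 = e, Y k ω * Y (k + d) ω|} ≤
        2 * Real.exp (1 - t) := fun e => by
    refine measureReal_abs_sum_ge_le (Z := fun k ω => Y k ω * Y (k + d) ω)
      (fun k => (hY k).mul (hY (k + d)))
      (fun k ω => ?_) hZ0 _ (fun i u hiu hsub => ?_) hV ?_ t
    · rw [abs_mul]; exact mul_le_one₀ (hY1 _ _) (abs_nonneg _) (hY1 _ _)
    · refine indepFun_mul_shift_sum hY hind hd (e := e) hiu ?_ fun j hj => ?_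
      · exact (Finset.mem_filter.1 (hsub (Finset.mem_insert_self i u))).2
      · exact (Finset.mem_filter.1 (hsub (Finset.mem_insert_of_mem hj))).2
    · refine (Finset.sum_le_sum fun k _ => hZ2 k).trans (le_trans ?_ hsV)
      exact Finset.sum_le_sum_of_subset_of_nonneg (Finset.filter_subset _ _)
        fun k _ _ => sq_nonneg _
  have hsub : {ω | 2 * (√V * t) ≤ |∑ k ∈ Finset.range n, Y k ω * Y (k + d) ω|} ⊆
      {ω | √V * t ≤ |∑ k ∈ Finset.range n with (k / d) % 2 = 0, Y k ω * Y (k + d) ω|} ∪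
      {ω | √V * t ≤ |∑ k ∈ Finset.range n with (k / d) % 2 = 1, Y k ω * Y (k + d) ω|} := by
    intro ω hω
    by_contra hcon
    simp only [Set.mem_union, Set.mem_ofPred_eq, not_or, not_le] at hcon hω
    have h1 := Finset.sum_filter_add_sum_filter_not (Finset.range n) (fun k => (k / d) % 2 = 0)
      fun k => Y k ω * Y (k + d) ω
    simp only [Nat.mod_two_not_eq_zero] at h1
    rw [← h1] at hω
    linarith [abs_add_le (∑ k ∈ Finset.range n with (k / d) % 2 = 0, Y k ω * Y (k + d) ω)
      (∑ k ∈ Finset.range n with (k / d) % 2 = 1, Y k ω * Y (k + d) ω), hcon.1, hcon.2]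
  refine (measureReal_mono hsub).trans ((measureReal_union_le _ _).trans ?_)
  linarith [hpar 0, hpar 1]

end Correlation

/-! ### Power sums -/

theorem sum_rpow_neg_le {s : ℝ} (hs0 : 0 < s) (hs1 : s < 1) (N : ℕ) :
    ∑ k ∈ Finset.range N, ((k : ℝ) + 1) ^ (-s) ≤ (N : ℝ) ^ (1 - s) / (1 - s) := by
  have h1s : 0 < 1 - s := by linarith
  induction N with
  | zero => simp [Real.zero_rpow h1s.ne']
  | succ N ih =>
    rw [Finset.sum_range_succ]
    have hN : (0 : ℝ) < (N : ℝ) + 1 := by positivity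
    have h1 : (N : ℝ) ^ (1 - s) ≤
        ((N : ℝ) + 1) ^ (1 - s) - (1 - s) * ((N : ℝ) + 1) ^ (-s) := by
      -- Bernoulli's inequality for an exponent in `[0, 1]`, that is, concavity of `x ^ (1 - s)`,
      -- compares one term with the increment.
      have h2 := rpow_one_add_le_one_add_mul_self (s := -1 / ((N : ℝ) + 1)) (p := 1 - s)
        (by rw [le_div_iff₀ hN]; nlinarith [Nat.cast_nonneg (α := ℝ) N]) h1s.le (by linarith)
      have h3 : 1 + -1 / ((N : ℝ) + 1) = (N : ℝ) / ((N : ℝ) + 1) := by field_simp; ring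
      rw [h3, Real.div_rpow (Nat.cast_nonneg N) hN.le, div_le_iff₀ (by positivity)] at h2
      refine h2.trans (le_of_eq ?_)
      have h4 : ((N : ℝ) + 1) ^ (-s) = ((N : ℝ) + 1) ^ (1 - s) / ((N : ℝ) + 1) := by
        rw [← Real.rpow_sub_one hN.ne']; congr 1; ring
      rw [h4]; field_simp; ring
    push_cast
    rw [le_div_iff₀ h1s] at ih ⊢
    nlinarith

theorem rpow_le_sum_rpow_neg {s : ℝ} (hs0 : 0 < s) (hs1 : s < 1) (N : ℕ) :
    (N : ℝ) ^ (1 - s) ≤ ∑ k ∈ Finset.range N, ((k : ℝ) + 1) ^ (-s) := by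
  rcases Nat.eq_zero_or_pos N with rfl | hN
  · simp [Real.zero_rpow (by linarith : 1 - s ≠ 0)]
  have hN' : (0 : ℝ) < N := by exact_mod_cast hN
  have h := Finset.card_nsmul_le_sum (Finset.range N) (fun k : ℕ => ((k : ℝ) + 1) ^ (-s))
    ((N : ℝ) ^ (-s)) fun k hk => by
      refine Real.rpow_le_rpow_of_nonpos (by positivity) ?_ (by linarith)
      exact_mod_cast Finset.mem_range.1 hk
  refine le_trans (le_of_eq ?_) h
  rw [Finset.card_range, nsmul_eq_mul, sub_eq_neg_add, Real.rpow_add_one hN'.ne', mul_comm]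

/-- The square root costs exponent `p / 2` and the logarithm fits in a further `p / 4`. It serves `p
= 1 - 2 * α` for correlations and `p = 1 - α` for counting. -/
theorem exists_sqrt_mul_log_le {p : ℝ} (hp : 0 < p) :
    ∃ K, 0 ≤ K ∧ ∀ N : ℕ, 1 ≤ N →
      √((N : ℝ) ^ p / p) * Real.log ((N : ℝ) + 1) ≤ K * (N : ℝ) ^ (3 * p / 4) := by
  refine ⟨√(1 / p) * (2 ^ (p / 4) / (p / 4)), by positivity, fun N hN => ?_⟩
  have hN1 : (1 : ℝ) ≤ N := by exact_mod_cast hN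
  have hN0 : (0 : ℝ) < N := by linarith
  have h1 : Real.log ((N : ℝ) + 1) ≤ 2 ^ (p / 4) * (N : ℝ) ^ (p / 4) / (p / 4) := by
    rw [← Real.mul_rpow (by norm_num) hN0.le]
    refine le_trans (Real.log_le_log (by positivity) (by linarith : (N : ℝ) + 1 ≤ 2 * N)) ?_
    exact Real.log_le_rpow_div (by positivity) (by positivity)
  have h2 : √((N : ℝ) ^ p / p) = √(1 / p) * (N : ℝ) ^ (p / 2) := by
    rw [div_eq_mul_one_div, mul_comm, Real.sqrt_mul (by positivity)]
    congr 1
    rw [Real.sqrt_eq_rpow, ← Real.rpow_mul hN0.le]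
    congr 1; ring
  have h3 : (N : ℝ) ^ (3 * p / 4) = (N : ℝ) ^ (p / 2) * (N : ℝ) ^ (p / 4) := by
    rw [← Real.rpow_add hN0]; congr 1; ring
  rw [h2, h3]
  calc √(1 / p) * (N : ℝ) ^ (p / 2) * Real.log ((N : ℝ) + 1)
      ≤ √(1 / p) * (N : ℝ) ^ (p / 2) * (2 ^ (p / 4) * (N : ℝ) ^ (p / 4) / (p / 4)) := by gcongr
    _ = _ := by ring

/-! ### Random selectors are almost surely pseudorandom -/

section RandomSequence

variable {Ω : Type*} [MeasurableSpace Ω] {P : Measure Ω} [IsProbabilityMeasure P]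

/-- Partial sums and autocorrelations of independent bounded centered variables almost surely
satisfy square root type bounds for all large lengths. -/
theorem ae_eventually_sum_and_correlation_lt {Y : ℕ → Ω → ℝ} (hY : ∀ k, Measurable (Y k))
    (hind : iIndepFun Y P) (hY1 : ∀ k ω, |Y k ω| ≤ 1) (hY0 : ∀ k, ∫ ω, Y k ω ∂P = 0)
    {τ : ℕ → ℝ} (hτ : Antitone τ) (hτ0 : ∀ k, 0 ≤ τ k)
    (hvar : ∀ k, ∫ ω, Y k ω ^ 2 ∂P ≤ τ k) {V W : ℕ → ℝ} (hV1 : ∀ N, 1 ≤ N → 1 ≤ V N)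
    (hW1 : ∀ N, 1 ≤ N → 1 ≤ W N) (hV : ∀ N, ∑ k ∈ Finset.range N, τ k ^ 2 ≤ V N)
    (hW : ∀ N, ∑ k ∈ Finset.range N, τ k ≤ W N) :
    ∀ᵐ ω ∂P, ∀ᶠ N : ℕ in atTop,
      |∑ k ∈ Finset.range N, Y k ω| < 4 * (√(W N) * Real.log ((N : ℝ) + 1)) ∧
      ∀ d < N, |∑ k ∈ Finset.range (N - (d + 1)), Y k ω * Y (k + (d + 1)) ω| <
        8 * (√(V N) * Real.log ((N : ℝ) + 1)) := by
  classical
  -- The deviation `4 * log (N + 1)` gives each event probability `O((N + 1) ^ (-4))`, still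
  -- summable after the union over `N` shifts, so Borel–Cantelli applies.
  let A : ℕ → Set Ω := fun N =>
    {ω | √(W N) * (4 * Real.log ((N : ℝ) + 1)) ≤ |∑ k ∈ Finset.range N, Y k ω|}
  let B : ℕ → ℕ → Set Ω := fun N d => {ω | 2 * (√(V N) * (4 * Real.log ((N : ℝ) + 1))) ≤
    |∑ k ∈ Finset.range (N - (d + 1)), Y k ω * Y (k + (d + 1)) ω|}
  let E : ℕ → Set Ω := fun N => A N ∪ ⋃ d ∈ Finset.range N, B N d
  have hexp : ∀ N : ℕ, Real.exp (1 - 4 * Real.log ((N : ℝ) + 1)) =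
      Real.exp 1 * (1 / ((N : ℝ) + 1) ^ 4) := fun N => by
    have h1 : 4 * Real.log ((N : ℝ) + 1) = Real.log (((N : ℝ) + 1) ^ 4) := by
      rw [Real.log_pow]; norm_num
    rw [Real.exp_sub, h1, Real.exp_log (by positivity)]
    ring
  have hA : ∀ N, 1 ≤ N → P.real (A N) ≤ 2 * Real.exp (1 - 4 * Real.log ((N : ℝ) + 1)) :=
    fun N hN => measureReal_abs_sum_ge_le hY hY1 hY0 (Finset.range N)
      (fun i t hit _ => by
        have := (hind.indepFun_finsetSum_of_notMem hY hit).symm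
        convert this using 1
        ext ω
        simp)
      (hW1 N hN) ((Finset.sum_le_sum fun k _ => hvar k).trans (hW N)) _
  have hB : ∀ N d, 1 ≤ N → P.real (B N d) ≤ 4 * Real.exp (1 - 4 * Real.log ((N : ℝ) + 1)) :=
    fun N d hN => measureReal_correlation_ge_le hY hind hY1 hY0 hτ hτ0 hvar (Nat.succ_pos d)
      (N - (d + 1)) (hV1 N hN) ((Finset.sum_le_sum_of_subset_of_nonneg
        (Finset.range_mono (Nat.sub_le _ _)) fun k _ _ => sq_nonneg _).trans (hV N)) _
  have hE : ∀ N, 1 ≤ N → P.real (E N) ≤ 4 * Real.exp 1 * (1 / ((N : ℝ) + 1) ^ 3) := by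
    intro N hN
    have h1 : P.real (E N) ≤ P.real (A N) + ∑ d ∈ Finset.range N, P.real (B N d) :=
      (measureReal_union_le _ _).trans (add_le_add le_rfl (measureReal_biUnion_finset_le _ _))
    have h2 : ∑ d ∈ Finset.range N, P.real (B N d) ≤
        N * (4 * Real.exp (1 - 4 * Real.log ((N : ℝ) + 1))) := by
      have := Finset.sum_le_card_nsmul (Finset.range N) (fun d => P.real (B N d)) _
        fun d _ => hB N d hN
      simpa using this
    have h3 := hA N hN
    rw [hexp] at h2 h3
    have h4 : (1 : ℝ) / ((N : ℝ) + 1) ^ 3 = ((N : ℝ) + 1) * (1 / ((N : ℝ) + 1) ^ 4) := by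
      field_simp
    have h5 : 0 ≤ Real.exp 1 * (1 / ((N : ℝ) + 1) ^ 4) := by positivity
    rw [h4]
    nlinarith
  have hsum : Summable fun N => P.real (E N) := by
    rw [← summable_nat_add_iff 1]
    have hs : Summable fun N : ℕ => 4 * Real.exp 1 * (1 / ((N + 2 : ℕ) : ℝ) ^ 3) :=
      ((summable_nat_add_iff 2).2 (Real.summable_one_div_nat_pow.2 (by norm_num))).mul_left _
    refine Summable.of_nonneg_of_le (fun N => measureReal_nonneg) (fun N => ?_) hs
    refine (hE (N + 1) (Nat.le_add_left 1 N)).trans (le_of_eq ?_)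
    push_cast
    ring
  have hne : ∑' N, P (E N) ≠ ∞ := by
    rw [tsum_congr fun N => (ofReal_measureReal (μ := P) (s := E N)).symm,
      ← ENNReal.ofReal_tsum_of_nonneg (fun N => measureReal_nonneg) hsum]
    exact ENNReal.ofReal_ne_top
  filter_upwards [ae_eventually_notMem hne] with ω hω
  filter_upwards [hω] with N hN
  simp only [E, Set.mem_union, not_or, Set.mem_iUnion, Finset.mem_range, not_exists] at hN
  refine ⟨?_, fun d hd => ?_⟩
  · have : |∑ k ∈ Finset.range N, Y k ω| < √(W N) * (4 * Real.log ((N : ℝ) + 1)) :=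
      not_le.1 hN.1
    linarith
  · have : |∑ k ∈ Finset.range (N - (d + 1)), Y k ω * Y (k + (d + 1)) ω| <
        2 * (√(V N) * (4 * Real.log ((N : ℝ) + 1))) := not_le.1 (hN.2 d hd)
    linarith

/-- Independent selectors of density `(k + 1) ^ (-α)`, `α < 1 / 2`, are almost surely
pseudorandom. -/
theorem ae_exists_isPseudorandom {α : ℝ} (hα₀ : 0 < α) (hα₁ : α < 1 / 2) {η : ℕ → Ω → ℝ}
    (hη : ∀ k, Measurable (η k)) (hind : iIndepFun η P) (hη01 : ∀ k ω, η k ω = 0 ∨ η k ω = 1)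
    (hmean : ∀ k : ℕ, ∫ ω, η k ω ∂P = ((k : ℝ) + 1) ^ (-α)) :
    ∀ᵐ ω ∂P, ∃ C, IsPseudorandom (fun k => η k ω) (fun k => ((k : ℝ) + 1) ^ (-α)) (1 - α)
      ((1 - 2 * α) / 4) C := by
  set τ : ℕ → ℝ := fun k => ((k : ℝ) + 1) ^ (-α) with hτdef
  have hτ0 : ∀ k, 0 ≤ τ k := fun k => by positivity
  have hτ1 : ∀ k, τ k ≤ 1 := fun k =>
    Real.rpow_le_one_of_one_le_of_nonpos (by linarith [Nat.cast_nonneg (α := ℝ) k]) (by linarith)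
  have hτ : Antitone τ := fun i j hij =>
    Real.rpow_le_rpow_of_nonpos (by positivity) (by gcongr) (by linarith)
  set Y : ℕ → Ω → ℝ := fun k ω => η k ω - τ k with hYdef
  have hY : ∀ k, Measurable (Y k) := fun k => (hη k).sub_const _
  have hYind : iIndepFun Y P := hind.comp (fun k x => x - τ k) fun k => measurable_id.sub_const _
  have hY1 : ∀ k ω, |Y k ω| ≤ 1 := fun k ω => by
    rw [hYdef, abs_le]
    have h0 := hτ0 k
    have h1 := hτ1 k
    rcases hη01 k ω with h | h <;> simp only [h] <;> constructor <;> linarith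
  have hηi : ∀ k, Integrable (η k) P := fun k => integrable_of_abs_le_one (hη k) fun ω => by
    rcases hη01 k ω with h | h <;> simp [h]
  have hY0 : ∀ k, ∫ ω, Y k ω ∂P = 0 := fun k => by
    rw [hYdef, integral_sub (hηi k) (integrable_const _), hmean]
    simp [hτdef]
  have hvar : ∀ k, ∫ ω, Y k ω ^ 2 ∂P ≤ τ k := fun k => by
    have h1 : ∀ ω, Y k ω ^ 2 = (1 - 2 * τ k) * η k ω + τ k ^ 2 := fun ω => by
      rcases hη01 k ω with h | h <;> simp only [hYdef, h] <;> ring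
    simp only [h1]
    rw [integral_add ((hηi k).const_mul _) (integrable_const _), integral_const_mul, hmean]
    simp only [integral_const, probReal_univ, smul_eq_mul, one_mul]
    change (1 - 2 * τ k) * τ k + τ k ^ 2 ≤ τ k
    nlinarith [hτ0 k]
  have hp : 0 < 1 - 2 * α := by linarith
  have hγ : 0 < 1 - α := by linarith
  have hone : ∀ p : ℝ, 0 < p → p ≤ 1 → ∀ N : ℕ, 1 ≤ N → 1 ≤ (N : ℝ) ^ p / p :=
    fun p hp0 hp1 N hN => by
      rw [le_div_iff₀ hp0, one_mul]
      exact hp1.trans (Real.one_le_rpow (by exact_mod_cast hN) hp0.le)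
  have hW : ∀ N : ℕ, ∑ k ∈ Finset.range N, τ k ≤ (N : ℝ) ^ (1 - α) / (1 - α) :=
    sum_rpow_neg_le hα₀ (by linarith)
  have hV : ∀ N : ℕ, ∑ k ∈ Finset.range N, τ k ^ 2 ≤ (N : ℝ) ^ (1 - 2 * α) / (1 - 2 * α) :=
    fun N => by
      refine le_trans (le_of_eq (Finset.sum_congr rfl fun k _ => ?_))
        (sum_rpow_neg_le (s := 2 * α) (by linarith) (by linarith) N)
      rw [hτdef, ← Real.rpow_mul_natCast (by positivity)]
      congr 1; push_cast; ring
  have hlow : ∀ N : ℕ, (N : ℝ) ^ (1 - α) ≤ ∑ k ∈ Finset.range N, τ k :=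
    rpow_le_sum_rpow_neg hα₀ (by linarith)
  obtain ⟨K₁, hK₁0, hK₁⟩ := exists_sqrt_mul_log_le hp
  obtain ⟨K₂, hK₂0, hK₂⟩ := exists_sqrt_mul_log_le hγ
  filter_upwards [ae_eventually_sum_and_correlation_lt hY hYind hY1 hY0 hτ hτ0 hvar
    (hone _ hp (by linarith)) (hone _ hγ (by linarith)) hV hW] with ω hω
  obtain ⟨N₀, hN₀⟩ := eventually_atTop.1 hω
  have hdiff : ∀ N ≥ max N₀ 1, |∑ k ∈ Finset.range N, η k ω - ∑ k ∈ Finset.range N, τ k| ≤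
      4 * K₂ * (N : ℝ) ^ (3 * (1 - α) / 4) := fun N hN => by
    have h1 := (hN₀ N ((le_max_left _ _).trans hN)).1
    have h2 := hK₂ N ((le_max_right _ _).trans hN)
    rw [hYdef, Finset.sum_sub_distrib] at h1
    linarith
  -- Below the random threshold `N₀` all sums are trivially at most `N₀`; beyond it `8 * K₁` serves
  -- the correlations and the last entry the counting functions.
  refine ⟨max (N₀ : ℝ) (max (8 * K₁) (1 / (1 - α) + 4 * K₂)), fun k => hη01 k ω, hτ, hτ0, hτ1,
    hγ, by linarith, by linarith, fun N => ?_, fun N => ?_, hlow, ?_, fun N d hd => ?_⟩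
  · rcases Nat.eq_zero_or_pos N with rfl | hN
    · simp [Real.zero_rpow hγ.ne']
    have hN1 : (1 : ℝ) ≤ N := by exact_mod_cast hN
    have hNγ : (1 : ℝ) ≤ (N : ℝ) ^ (1 - α) := Real.one_le_rpow hN1 hγ.le
    rcases Nat.lt_or_ge N N₀ with hlt | hge
    · have h1 : ∑ k ∈ Finset.range N, η k ω ≤ N := by
        have := Finset.sum_le_card_nsmul (Finset.range N) (fun k => η k ω) 1 fun k _ => by
          rcases hη01 k ω with h | h <;> simp [h]
        simpa using this
      have h2 : (N : ℝ) ≤ N₀ := by exact_mod_cast hlt.le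
      calc ∑ k ∈ Finset.range N, η k ω ≤ N₀ * 1 := by linarith
        _ ≤ _ := mul_le_mul (le_max_left _ _) hNγ zero_le_one
            ((Nat.cast_nonneg _).trans (le_max_left _ _))
    · have h1 := (abs_le.1 (hdiff N (max_le hge hN))).2
      have h2 : (N : ℝ) ^ (3 * (1 - α) / 4) ≤ (N : ℝ) ^ (1 - α) :=
        Real.rpow_le_rpow_of_exponent_le hN1 (by linarith)
      calc ∑ k ∈ Finset.range N, η k ω
          ≤ (N : ℝ) ^ (1 - α) / (1 - α) + 4 * K₂ * (N : ℝ) ^ (1 - α) := by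
            nlinarith [hW N]
        _ = (1 / (1 - α) + 4 * K₂) * (N : ℝ) ^ (1 - α) := by ring
        _ ≤ _ := mul_le_mul_of_nonneg_right ((le_max_right _ _).trans (le_max_right _ _))
            (by positivity)
  · refine (hW N).trans ?_
    rw [div_eq_mul_one_div, mul_comm]
    refine mul_le_mul_of_nonneg_right ?_ (by positivity)
    refine le_trans ?_ ((le_max_right _ _).trans (le_max_right _ _))
    linarith
  · have hlim : Tendsto (fun N : ℕ => 4 * K₂ * (N : ℝ) ^ (-((1 - α) / 4))) atTop (𝓝 0) := by
      have := ((tendsto_rpow_neg_atTop (by linarith : 0 < (1 - α) / 4)).comp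
        tendsto_natCast_atTop_atTop).const_mul (4 * K₂)
      simpa using this
    rw [tendsto_iff_norm_sub_tendsto_zero]
    refine squeeze_zero' (Eventually.of_forall fun N => norm_nonneg _) ?_ hlim
    filter_upwards [eventually_ge_atTop (max N₀ 1)] with N hN
    have hN1 : 1 ≤ N := (le_max_right _ _).trans hN
    have hN0 : (0 : ℝ) < N := by exact_mod_cast hN1
    have hpos : 0 < (N : ℝ) ^ (1 - α) := by positivity
    have hβ : 0 < ∑ k ∈ Finset.range N, τ k := hpos.trans_le (hlow N)
    rw [div_sub_one hβ.ne', norm_div, Real.norm_of_nonneg hβ.le, Real.norm_eq_abs]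
    have h2 : (N : ℝ) ^ (-((1 - α) / 4)) = (N : ℝ) ^ (3 * (1 - α) / 4) / (N : ℝ) ^ (1 - α) := by
      rw [← Real.rpow_sub hN0]; congr 1; ring
    rw [h2, ← mul_div_assoc]
    exact div_le_div₀ (by positivity) (hdiff N hN) hpos (hlow N)
  · have hN : 1 ≤ N := by omega
    have hN1 : (1 : ℝ) ≤ N := by exact_mod_cast hN
    -- The value of `δ` is chosen so that the required exponent is the one obtained by absorbing the
    -- logarithm.
    have hexp : 2 * (1 - α) - 1 - (1 - 2 * α) / 4 = 3 * (1 - 2 * α) / 4 := by ring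
    rw [hexp]
    have hNp : (1 : ℝ) ≤ (N : ℝ) ^ (3 * (1 - 2 * α) / 4) :=
      Real.one_le_rpow hN1 (by linarith)
    change |∑ k ∈ Finset.range (N - (d + 1)), Y k ω * Y (k + (d + 1)) ω| ≤ _
    rcases Nat.lt_or_ge N N₀ with hlt | hge
    · have h1 : |∑ k ∈ Finset.range (N - (d + 1)), Y k ω * Y (k + (d + 1)) ω| ≤
          ((N - (d + 1) : ℕ) : ℝ) := by
        refine (Finset.abs_sum_le_sum_abs _ _).trans ?_
        have := Finset.sum_le_card_nsmul (Finset.range (N - (d + 1)))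
          (fun k => |Y k ω * Y (k + (d + 1)) ω|) 1 fun k _ => by
            rw [abs_mul]; exact mul_le_one₀ (hY1 _ _) (abs_nonneg _) (hY1 _ _)
        simpa using this
      have h2 : ((N - (d + 1) : ℕ) : ℝ) ≤ N₀ := by exact_mod_cast (by omega)
      calc |∑ k ∈ Finset.range (N - (d + 1)), Y k ω * Y (k + (d + 1)) ω| ≤ N₀ * 1 := by linarith
        _ ≤ _ := mul_le_mul (le_max_left _ _) hNp zero_le_one
            ((Nat.cast_nonneg _).trans (le_max_left _ _))
    · have h1 := (hN₀ N hge).2 d hd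
      have h2 := hK₁ N hN
      calc |∑ k ∈ Finset.range (N - (d + 1)), Y k ω * Y (k + (d + 1)) ω|
          ≤ 8 * K₁ * (N : ℝ) ^ (3 * (1 - 2 * α) / 4) := by linarith
        _ ≤ _ := mul_le_mul_of_nonneg_right ((le_max_left _ _).trans (le_max_right _ _))
            (by positivity)

end RandomSequence

/-! ### From weighted averages to averages along the selected set -/

theorem sum_range_nth_eq {S : Set ℕ} (hS : S.Infinite) [DecidablePred fun j => j ∈ S]
    {M : Type*} [AddCommMonoid M] (φ : ℕ → M) (N : ℕ) :
    ∑ k ∈ Finset.range N, φ (Nat.nth (fun j => j ∈ S) k) =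
      ∑ i ∈ Finset.range (Nat.nth (fun j => j ∈ S) N), if i ∈ S then φ i else 0 := by
  have hinf : (Set.ofPred fun j => j ∈ S).Infinite := hS
  rw [← Finset.sum_filter]
  refine Finset.sum_nbij (Nat.nth fun j => j ∈ S) (fun k hk => ?_)
    (fun i _ j _ hij => Nat.nth_injective hinf hij) (fun i hi => ?_) fun _ _ => rfl
  · exact Finset.mem_filter.2 ⟨Finset.mem_range.2
      (Nat.nth_strictMono hinf (Finset.mem_range.1 hk)), Nat.nth_mem_of_infinite hinf k⟩
  · obtain ⟨hi1, hi2⟩ := Finset.mem_filter.1 (Finset.mem_coe.1 hi)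
    refine ⟨Nat.count (fun j => j ∈ S) i, ?_, Nat.nth_count hi2⟩
    refine Finset.mem_coe.2 (Finset.mem_range.2 ((Nat.nth_strictMono hinf).lt_iff_lt.1 ?_))
    rw [Nat.nth_count hi2]
    exact Finset.mem_range.1 hi1

/-- If the indicator sequence of a set of positive integers is pseudorandom, then the set is
universally `L¹`-good. -/
theorem universallyLpGoodSet_of_isPseudorandom {S : Set ℕ} (h0 : 0 ∉ S) {a τ : ℕ → ℝ}
    {γ δ C : ℝ} (h : IsPseudorandom a τ γ δ C) (haS : ∀ k, a k = 1 ↔ k + 1 ∈ S) :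
    UniversallyLpGoodSet.{u} 1 S := by
  classical
  have ha : ∀ k, a k = if k + 1 ∈ S then 1 else 0 := fun k => by
    rcases h.zero_or_one k with hk | hk
    · rw [if_neg fun hmem => zero_ne_one (hk.symm.trans ((haS k).2 hmem)), hk]
    · rw [if_pos ((haS k).1 hk), hk]
  have hS : S.Infinite := by
    intro hfin
    have hbound : ∀ N, ∑ k ∈ Finset.range N, a k ≤ hfin.toFinset.card := fun N => by
      simp only [ha]
      rw [Finset.sum_boole]
      exact_mod_cast Finset.card_le_card_of_injOn (· + 1)
        (fun k hk => by simpa using (Finset.mem_filter.1 (Finset.mem_coe.1 hk)).2)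
        fun i _ j _ hij => Nat.add_right_cancel hij
    have hlim : Tendsto (fun N : ℕ => (N : ℝ) ^ γ / 2) atTop atTop :=
      ((tendsto_rpow_atTop h.exponent_pos).comp tendsto_natCast_atTop_atTop).atTop_div_const
        two_pos
    obtain ⟨N, hN1, hN2⟩ :=
      (h.eventually_half_le_sum.and (hlim.eventually_gt_atTop (hfin.toFinset.card : ℝ))).exists
    linarith [hbound N]
  refine ⟨hS, fun X _ m _ T hT f hf => ?_⟩
  have hinf : (Set.ofPred fun j => j ∈ S).Infinite := hS
  set n := Nat.nth fun j => j ∈ S with hn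
  have hnpos : ∀ N, 0 < n N := fun N => Nat.pos_of_ne_zero fun hz =>
    h0 (hz ▸ Nat.nth_mem_of_infinite hinf N)
  -- Index `k` of `a` stands for the integer `k + 1`, so the first `N` elements, those below `n N`,
  -- correspond to `k < n N - 1`.
  have hsum : ∀ (φ : ℕ → ℂ) (N : ℕ), ∑ k ∈ Finset.range N, φ (n k) =
      ∑ k ∈ Finset.range (n N - 1), (a k : ℂ) * φ (k + 1) := fun φ N => by
    rw [hn, sum_range_nth_eq hS φ N, ← hn]
    conv_lhs => rw [← Nat.sub_add_cancel (hnpos N)]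
    rw [Finset.sum_range_succ', if_neg h0, add_zero]
    refine Finset.sum_congr rfl fun k _ => ?_
    rw [ha k]
    split_ifs <;> simp
  have hcount : ∀ N, ((∑ k ∈ Finset.range (n N - 1), a k : ℝ) : ℂ) = N := fun N => by
    have := hsum (fun _ => 1) N
    simp only [mul_one, Finset.sum_const, Finset.card_range, nsmul_eq_mul] at this
    rw [Complex.ofReal_sum, ← this]
  have hlim : Tendsto (fun N => n N - 1) atTop atTop :=
    (tendsto_sub_atTop_nat 1).comp (Nat.nth_strictMono hinf).tendsto_atTop
  -- The index shift is absorbed by evaluating the convergence at `T x`, as `T^[k + 1] x = T^[k] (T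
  -- x)`.
  filter_upwards [hT.quasiMeasurePreserving.ae (ae_exists_tendsto_average h hT hf)]
    with x ⟨L, hL⟩
  refine ⟨L, (hL.comp hlim).congr fun N => ?_⟩
  rw [Function.comp_apply, hcount, subseqAverage, hsum (fun i => f (T^[i] x)) N, div_eq_inv_mul]
  simp only [Function.iterate_succ_apply]

theorem theorem1 {Ω : Type v} [MeasurableSpace Ω] (P : Measure Ω) [IsProbabilityMeasure P]
    (α : ℝ) (hα₀ : 0 < α) (hα₁ : α < 1 / 2) (ξ : ℕ+ → Ω → ℝ)
    (hξ : IsSelectorSequence P (fun n => ((n : ℕ) : ℝ) ^ (-α)) ξ) :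
    ∃ Ω' : Set Ω, MeasurableSet Ω' ∧ P Ω' = 1 ∧
      ∀ ω ∈ Ω', UniversallyLpGoodSet.{u} 1 (selectedSet ξ ω) := by
  classical
  -- The selectors are `0` or `1` only almost surely; composing with `ψ` makes this hold everywhere
  -- without changing the selected set.
  set ψ : ℝ → ℝ := fun t => if t = 1 then 1 else 0 with hψdef
  have hψ : Measurable ψ :=
    Measurable.ite (measurableSet_singleton 1) measurable_const measurable_const
  have hψ1 : ∀ t, ψ t = 1 ↔ t = 1 := fun t => by simp [hψdef]
  let η : ℕ → Ω → ℝ := fun k ω => ψ (ξ k.succPNat ω)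
  have hη : ∀ k, Measurable (η k) := fun k => hψ.comp (hξ.measurable _)
  have hind : iIndepFun η P :=
    (hξ.indep.precomp Nat.succPNat_injective).comp (fun _ => ψ) fun _ => hψ
  have hη01 : ∀ k ω, η k ω = 0 ∨ η k ω = 1 := fun k ω => by
    simp only [η, hψdef]
    split_ifs <;> simp
  have hmean : ∀ k : ℕ, ∫ ω, η k ω ∂P = ((k : ℝ) + 1) ^ (-α) := fun k => by
    have h1 : η k = Set.indicator {ω | ξ k.succPNat ω = 1} 1 := by
      ext ω
      simp [η, hψdef, Set.indicator_apply]
    have h2 : MeasurableSet {ω | ξ k.succPNat ω = 1} :=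
      hξ.measurable _ (measurableSet_singleton 1)
    rw [h1, integral_indicator_one h2, hξ.prob_one]
    simp
  have hae := ae_exists_isPseudorandom hα₀ hα₁ hη hind hη01 hmean
  rw [ae_iff] at hae
  -- The set of non-pseudorandom outcomes is null but perhaps not measurable, so the complement of a
  -- measurable null hull is taken.
  refine ⟨(toMeasurable P _)ᶜ, (measurableSet_toMeasurable P _).compl,
    (prob_compl_eq_one_iff (measurableSet_toMeasurable P _)).2
      ((measure_toMeasurable _).trans hae), fun ω hω => ?_⟩
  obtain ⟨C, hC⟩ := not_not.1 fun hcon => hω (subset_toMeasurable P _ hcon)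
  refine universallyLpGoodSet_of_isPseudorandom ?_ hC fun k => ?_
  · rintro ⟨n, hn, -⟩
    exact n.ne_zero hn
  · rw [hψ1]
    refine ⟨fun h => ⟨k.succPNat, rfl, h⟩, ?_⟩
    rintro ⟨n, hn, hn1⟩
    have : n = k.succPNat := PNat.eq hn
    rwa [← this]
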